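/- Let $\Omega=(a,b)$ be a bounded interval, $0<\alpha<1$, $1<p<\infty$, $q=p/(p-1)$, $0\le\theta\le1$, $\lambda\in\{0,1\}$ and $f\in L^q(\Omega)$. Notation. For $\beta>0$ let ${}^-I^\beta g(x)=\frac1{\Gamma(\beta)}\int_a^x(x-y)^{\beta-1}g(y)\,dy$ and ${}^+I^\beta g(x)=\frac1{\Gamma(\beta)}\int_x^b(y-x)^{\beta-1}g(y)\,dy$. For $\varphi\in C_0^\infty(\Omega)$ let ${}^-D^\alpha\varphi={}^-I^{1-\alpha}\varphi'$ and ${}^+D^\alpha\varphi=-\,{}^+I^{1-\alpha}\varphi'$. For $u\in L^1(\Omega)$, the left/right weak fractional derivative ${}^\pm\mathcal D^\alpha u$ ($-$ is left, $+$ is right) is the function $w\in L^1_{loc}(\Omega)$, if there is one, with $\int_\Omega w\varphi=\int_\Omega u\,{}^\mp D^\alpha\varphi$ for all $\varphi\in C_0^\infty(\Omega)$. Let ${}^\pm W^{\alpha,p}=\{u\in L^p(\Omega):{}^\pm\mathcal D^\alpha u\in L^p(\Omega)\}$, let ${}^-\mathring W^{\alpha,p}$ (respectively ${}^+\mathring W^{\alpha,p}$)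 be the subspace of ${}^-W^{\alpha,p}$ (respectively ${}^+W^{\alpha,p}$) on which ${}^-I^{1-\alpha}u$ vanishes at $a$ (respectively ${}^+I^{1-\alpha}u$ vanishes at $b$), endpoint values being essential one-sided limits. Let $\mathcal W=\mathcal W^{\alpha,p}_{\theta,\lambda}$ be ${}^-W^{\alpha,p}\cap{}^+W^{\alpha,p}$ if $0<\theta<1$; ${}^-\mathring W^{\alpha,p}$ or ${}^-W^{\alpha,p}$ if $\theta=0$ and $\lambda=0$ or $\lambda=1$; ${}^+\mathring W^{\alpha,p}$ or ${}^+W^{\alpha,p}$ if $\theta=1$ and $\lambda=0$ or $\lambda=1$. Put $$\mathcal E(v)=\int_\Omega\Big(\tfrac1p\big((1-\theta)|{}^-\mathcal D^\alpha v|^p+\theta|{}^+\mathcal D^\alpha v|^p+\lambda|v|^p\big)-fv\Big)dx ,$$ $w_\pm=|{}^\pm\mathcal D^\alpha u|^{p-2}\,{}^\pm\mathcal D^\alpha u$ and ${}^\pm\Delta^\alpha_pu={}^\mp\mathcal D^\alpha w_\pm$, understood as the distribution $\varphi\mapsto\int_\Omega w_\pm\,{}^\pm D^\alpha\varphi\,dx$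 on $\Omega$. The fractional Neumann boundary operators ${}^-\mathcal N^\alpha_pu$ and ${}^+\mathcal N^\alpha_pu$ are the trace at $b$ of $J_-={}^+I^{1-\alpha}w_-$ and the trace at $a$ of $J_+={}^-I^{1-\alpha}w_+$. A term with coefficient $0$ is absent throughout ($1-\theta$ for $\theta=1$, $\theta$ for $\theta=0$), whether or not the derivative in it exists. Theorem. Suppose that $u\in\mathcal W$ and $\mathcal E(u)\le\mathcal E(v)$ for all $v\in\mathcal W$. Then the following hold. 1. In the sense of distributions on $\Omega$, $(1-\theta)\,{}^-\Delta^\alpha_pu+\theta\,{}^+\Delta^\alpha_pu+\lambda|u|^{p-2}u=f$. 2. The Neumann conditions $(1-\theta)\,{}^-\mathcal N^\alpha_pu=0$ and $\theta\,{}^+\mathcal N^\alpha_pu=0$ hold in the distributional sense, meaning (i) and (ii): (i) no boundary term is left in the first variation: for every $v\in\mathcal W$, $$\int_\Omega\Big((1-\theta)w_-\,{}^-\mathcal D^\alpha v+\theta w_+\,{}^+\mathcal D^\alpha v+\lambda|u|^{p-2}uv\Big)dx=\int_\Omega fv\,dx;$$ (ii) each of the two boundary pairings with admissible variations vanishes: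 for every $v\in\mathcal W$ the function $(1-\theta)J_-v$ is integrable near $b$, the function $\theta J_+v$ is integrable near $a$, and $$\lim_{\varepsilon\downarrow0}\frac1\varepsilon\int_{b-\varepsilon}^b(1-\theta)J_-v\,dx=0,\qquad\lim_{\varepsilon\downarrow0}\frac1\varepsilon\int_a^{a+\varepsilon}\theta J_+v\,dx=0 .$$ 3. If $\theta\in\{0,1\}$ or $\alpha p<1$, these conditions hold for the traces themselves: $(1-\theta)J_-(x)\to0$ as $x\uparrow b$ and $\theta J_+(x)\to0$ as $x\downarrow a$, as essential limits. If $\alpha p\le1$, then $(1-\theta)J_-$ is integrable near $b$, $\theta J_+$ is integrable near $a$, and $\frac1\varepsilon\int_{b-\varepsilon}^b(1-\theta)J_-\,dx\to0$ and $\frac1\varepsilon\int_a^{a+\varepsilon}\theta J_+\,dx\to0$ as $\varepsilon\downarrow0$. -/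

import Mathlib

open MeasureTheory Set Filter Topology
open scoped ContDiff

noncomputable section

namespace FracVar

/-- The two directions of one-sided fractional calculus: `left` is the superscript `-` (integration
from the left endpoint `a`), `right` is the superscript `+` (integration from the right
endpoint `b`). -/
inductive Side where
  | left : Side
  | right : Side

/-- The opposite direction. -/
def Side.opp : Side → Side
  | .left => .right
  | .right => .left

/-- Left and right Riemann-Liouville fractional integrals of order `β > 0` on `(a, b)`. -/
def fracInt (s : Side) (β a b : ℝ) (g : ℝ → ℝ) (x : ℝ) : ℝ :=
  match s with
  | .left => (Real.Gamma β)⁻¹ * ∫ y in Ioo a x, (x - y) ^ (β - 1) * g y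
  | .right => (Real.Gamma β)⁻¹ * ∫ y in Ioo x b, (y - x) ^ (β - 1) * g y

/-- Test functions: smooth with compact support in `(a, b)`. -/
def IsTest (a b : ℝ) (φ : ℝ → ℝ) : Prop :=
  ContDiff ℝ ∞ φ ∧ HasCompactSupport φ ∧ tsupport φ ⊆ Ioo a b

/-- Classical one-sided derivative of order `0 < α < 1` of a test function, at points of `(a, b)`.
On test functions the Riemann-Liouville, Caputo, ... derivatives agree; this is the Caputo form
`I^{1-α} φ'` (left) and `I^{1-α} (-φ')` (right). -/
def testDeriv (s : Side) (α a b : ℝ) (φ : ℝ → ℝ) (x : ℝ) : ℝ :=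
  match s with
  | .left => fracInt .left (1 - α) a b (deriv φ) x
  | .right => fracInt .right (1 - α) a b (fun y => -deriv φ y) x

/-- `w` is the left/right weak fractional derivative of order `0 < α < 1` of `u` on `(a, b)`. -/
def IsWeakDeriv (s : Side) (α a b : ℝ) (u w : ℝ → ℝ) : Prop :=
  IntegrableOn u (Ioo a b) ∧ LocallyIntegrableOn w (Ioo a b) ∧
    ∀ φ : ℝ → ℝ, IsTest a b φ →
      ∫ x in Ioo a b, w x * φ x = ∫ x in Ioo a b, u x * testDeriv s.opp α a b φ x

open Classical in
/-- The left/right weak fractional derivative of `u` (unique up to null sets of `(a, b)`), with the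
value `0` if `u` has none. -/
def weakDeriv (s : Side) (α a b : ℝ) (u : ℝ → ℝ) : ℝ → ℝ :=
  if h : ∃ w, IsWeakDeriv s α a b u w then h.choose else 0

/-- Approach, up to null sets, to the endpoint where integration in direction `s` starts:
`a` for `left`, `b` for `right`. -/
def startFilter (s : Side) (a b : ℝ) : Filter ℝ :=
  match s with
  | .left => 𝓝[>] a ⊓ ae volume
  | .right => 𝓝[<] b ⊓ ae volume

/-- `HasTrace s a b J c`: the trace of direction `s` of (the class of) `J` is `c`, that is, `J` has
the essential limit `c` at the endpoint `b` for `left`, and at the endpoint `a` for `right`. -/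
def HasTrace (s : Side) (a b : ℝ) (J : ℝ → ℝ) (c : ℝ) : Prop :=
  Tendsto J (startFilter s.opp a b) (𝓝 c)

/-- The part of `(a, b)` within distance `ε` of the endpoint that carries the trace of
direction `s`. -/
def boundaryLayer (s : Side) (a b ε : ℝ) : Set ℝ :=
  match s with
  | .left => Ioo (b - ε) b
  | .right => Ioo a (a + ε)

/-- `J` has the trace `c` of direction `s` in the sense of mean values over shrinking boundary
layers; for `J` integrable near the endpoint this is weaker than `HasTrace`. -/
def HasMeanTrace (s : Side) (a b : ℝ) (J : ℝ → ℝ) (c : ℝ) : Prop :=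
  (∃ δ > 0, IntegrableOn J (boundaryLayer s a b δ)) ∧
    Tendsto (fun ε : ℝ => ε⁻¹ * ∫ x in boundaryLayer s a b ε, J x) (𝓝[>] 0) (𝓝 c)

/-- The one-sided fractional Sobolev space of order `0 < α < 1` on `(a, b)`. -/
def oneSidedSobolev (s : Side) (α p a b : ℝ) : Set (ℝ → ℝ) :=
  {u | MemLp u (ENNReal.ofReal p) (volume.restrict (Ioo a b)) ∧
    ∃ w, IsWeakDeriv s α a b u w ∧
      MemLp w (ENNReal.ofReal p) (volume.restrict (Ioo a b))}

/-- The subspace on which `I^{1-α} u` (of direction `s`) vanishes at the endpoint where the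
integration starts. -/
def ringSobolev (s : Side) (α p a b : ℝ) : Set (ℝ → ℝ) :=
  {u | u ∈ oneSidedSobolev s α p a b ∧
    Tendsto (fracInt s (1 - α) a b u) (startFilter s a b) (𝓝 0)}

open Classical in
/-- The energy space with parameters `θ ∈ [0, 1]` and `lam ∈ {0, 1}`, without essential boundary
conditions. -/
def energySpace (α p θ lam a b : ℝ) : Set (ℝ → ℝ) :=
  if θ = 0 then
    if lam = 0 then ringSobolev .left α p a b else oneSidedSobolev .left α p a b
  else if θ = 1 then
    if lam = 0 then ringSobolev .right α p a b else oneSidedSobolev .right α p a b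
  else oneSidedSobolev .left α p a b ∩ oneSidedSobolev .right α p a b

/-- The generalized `p`-energy. -/
def energy (α p θ lam a b : ℝ) (f v : ℝ → ℝ) : ℝ :=
  ∫ x in Ioo a b,
    (1 / p * ((1 - θ) * |weakDeriv .left α a b v x| ^ p + θ * |weakDeriv .right α a b v x| ^ p
      + lam * |v x| ^ p) - f x * v x)

/-- `u` minimizes the energy over the energy space. -/
def IsMinimizer (α p θ lam a b : ℝ) (f u : ℝ → ℝ) : Prop :=
  u ∈ energySpace α p θ lam a b ∧
    ∀ v ∈ energySpace α p θ lam a b, energy α p θ lam a b f u ≤ energy α p θ lam a b f v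

/-- `|D u| ^ (p - 2) * D u` with the weak fractional derivative `D` of direction `s`. -/
def flux (s : Side) (α p a b : ℝ) (u : ℝ → ℝ) (x : ℝ) : ℝ :=
  |weakDeriv s α a b u x| ^ (p - 2) * weakDeriv s α a b u x

/-- The one-sided fractional `p`-Laplacian of `u` as a distribution on `(a, b)`: the weak
fractional derivative, of direction opposite to `s`, of `flux s`. -/
def pLaplacian (s : Side) (α p a b : ℝ) (u : ℝ → ℝ) (φ : ℝ → ℝ) : ℝ :=
  ∫ x in Ioo a b, flux s α p a b u x * testDeriv s α a b φ x

/-- The Euler-Lagrange equation in the sense of distributions on `(a, b)`. -/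
def SatisfiesEulerLagrange (α p θ lam a b : ℝ) (f u : ℝ → ℝ) : Prop :=
  ∀ φ : ℝ → ℝ, IsTest a b φ →
    (1 - θ) * pLaplacian .left α p a b u φ + θ * pLaplacian .right α p a b u φ
      + lam * ∫ x in Ioo a b, |u x| ^ (p - 2) * u x * φ x = ∫ x in Ioo a b, f x * φ x

/-- The function whose trace of direction `s` is the fractional Neumann boundary operator:
the fractional integral of order `1 - α`, of direction opposite to `s`, of `flux s`. -/
def neumannFlux (s : Side) (α p a b : ℝ) (u : ℝ → ℝ) : ℝ → ℝ :=
  fracInt s.opp (1 - α) a b (flux s α p a b u)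

/-- Weak form, over all of the energy space, of the Euler-Lagrange equation together with the
natural boundary conditions: no boundary term is left in the first variation. -/
def SatisfiesWeakForm (α p θ lam a b : ℝ) (f u : ℝ → ℝ) : Prop :=
  ∀ v ∈ energySpace α p θ lam a b,
    ∫ x in Ioo a b, ((1 - θ) * (flux .left α p a b u x * weakDeriv .left α a b v x)
        + θ * (flux .right α p a b u x * weakDeriv .right α a b v x)
        + lam * (|u x| ^ (p - 2) * u x * v x)) = ∫ x in Ioo a b, f x * v x

/-- `k` times the Neumann operator of direction `s` vanishes at `u` in the distributional sense:
the boundary pairing of `k * neumannFlux s u` with every admissible variation `v ∈ V` vanishes. -/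
def NeumannVanishes (s : Side) (k α p a b : ℝ) (V : Set (ℝ → ℝ)) (u : ℝ → ℝ) : Prop :=
  ∀ v ∈ V, HasMeanTrace s a b (fun x => k * neumannFlux s α p a b u x * v x) 0

end FracVar

end

/-! The energy space is linear, and along a line `u + t v` every term of the energy is
differentiable at `t = 0` by dominated convergence. Minimality makes this derivative vanish, which
is the weak form for all admissible `v`; restricted to test functions, whose weak derivatives are
the classical ones, it is the Euler-Lagrange equation (`IsMinimizer.satisfiesWeakForm`,
`SatisfiesWeakForm.satisfiesEulerLagrange`).

The boundary statements have two different sources. If only one direction `s` enters the energy, the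
weak form is tested with `v = I^α (I^{1-α} φ)`, whose derivative is `I^{1-α} φ` and which equals
`I^1 φ`. Fractional integration by parts then identifies the Neumann flux with the order-one
integral of `g = f - lam |u|^{p-2} u`, taken from the endpoint of the trace (`neumannFlux_ae_eq`).
Such a primitive tends to zero there, and Hölder's inequality handles its pairing with `v`.

If both directions enter, membership in the space already suffices. A function with an integrable
derivative of direction `s` is a multiple of the kernel with pole at the starting endpoint plus a
fractional integral (`IsWeakDeriv.exists_ae_eq`). On a layer of width `ε` at that endpoint the
kernel has mass of order `ε^α`. Fractional integrals of order `α` of integrable functions, and the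
kernel with pole at the other endpoint, have mass `o(ε^α)`. Comparing the two representations of `v`
therefore removes the singular part (`ae_eq_fracInt_of_isWeakDeriv`). The pairing becomes a product
of fractional integrals of orders `1 - α` and `α`, both starting at the endpoint in question, and
its mean over the layer is bounded by a constant times the integrals over the layer of `|w|^q` and
`|k|^p`, where `w` is the flux and `k` the derivative of `v` of the opposite direction
(`layerSmall_fracInt_mul_fracInt`). These tend to zero.

The Neumann flux alone is controlled by the size of the kernel: for `α p < 1` the kernel of order `1
- α` is locally in `L^p`, which gives a genuine trace; for `α p ≤ 1` the powers of `ε` still balance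
for means. -/

open scoped ENNReal

noncomputable section

namespace FracVar

/-! ### One-sided kernels -/

/-- The kernel of the one-sided fractional integral of order `β`, without its normalisation. -/
def kern (s : Side) (β x y : ℝ) : ℝ :=
  match s with
  | .left => if y < x then |x - y| ^ (β - 1) else 0
  | .right => if x < y then |x - y| ^ (β - 1) else 0

/-- The two-sided kernel that dominates both one-sided kernels. -/
def riesz (β x y : ℝ) : ℝ≥0∞ := ENNReal.ofReal (|x - y| ^ (β - 1))

/-- The endpoint at which integration in direction `s` starts. -/
def startPt (s : Side) (a b : ℝ) : ℝ :=
  match s with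
  | .left => a
  | .right => b

@[simp] lemma Side.opp_opp (s : Side) : s.opp.opp = s := by cases s <;> rfl

/-- Transposing the kernel reverses the direction: together with Fubini this is the whole of
fractional integration by parts. -/
lemma kern_opp (s : Side) (β x y : ℝ) : kern s.opp β x y = kern s β y x := by
  cases s <;> simp [kern, Side.opp, abs_sub_comm]

lemma kern_nonneg (s : Side) (β x y : ℝ) : 0 ≤ kern s β x y := by
  cases s <;> simp only [kern] <;> split_ifs <;> positivity

lemma kern_le (s : Side) (β x y : ℝ) : kern s β x y ≤ |x - y| ^ (β - 1) := by
  cases s <;> simp only [kern] <;> split_ifs <;> first | exact le_rfl | positivity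

lemma enorm_kern_le (s : Side) (β x y : ℝ) : ‖kern s β x y‖ₑ ≤ riesz β x y := by
  rw [Real.enorm_eq_ofReal (kern_nonneg ..)]
  exact ENNReal.ofReal_le_ofReal (kern_le ..)

lemma measurable_kern (s : Side) (β : ℝ) : Measurable (fun z : ℝ × ℝ => kern s β z.1 z.2) := by
  cases s
  · exact Measurable.ite (measurableSet_lt measurable_snd measurable_fst)
      (by fun_prop) (by fun_prop)
  · exact Measurable.ite (measurableSet_lt measurable_fst measurable_snd)
      (by fun_prop) (by fun_prop)

lemma measurable_riesz (β : ℝ) : Measurable (fun z : ℝ × ℝ => riesz β z.1 z.2) := by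
  unfold riesz; fun_prop

lemma measurable_riesz_left (β y : ℝ) : Measurable fun x => riesz β x y := by
  unfold riesz; fun_prop

lemma measurable_riesz_right (β x : ℝ) : Measurable fun y => riesz β x y := by
  unfold riesz; fun_prop

lemma riesz_comm (β x y : ℝ) : riesz β x y = riesz β y x := by simp [riesz, abs_sub_comm]

lemma setIntegral_Ioo_left {a b x : ℝ} (h : x ∈ Ioo a b) (F : ℝ → ℝ) :
    ∫ y in Ioo a x, F y = ∫ y in Ioo a b, if y < x then F y else 0 := by
  have : (fun y => if y < x then F y else 0) = (Iio x).indicator F := by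
    ext y; simp [indicator]
  rw [this, setIntegral_indicator measurableSet_Iio]
  congr 2; ext y; simp only [mem_Ioo, mem_inter_iff, mem_Iio]; constructor
  · rintro ⟨h1, h2⟩; exact ⟨⟨h1, h2.trans h.2⟩, h2⟩
  · rintro ⟨h1, h2⟩; exact ⟨h1.1, h2⟩

lemma setIntegral_Ioo_right {a b x : ℝ} (h : x ∈ Ioo a b) (F : ℝ → ℝ) :
    ∫ y in Ioo x b, F y = ∫ y in Ioo a b, if x < y then F y else 0 := by
  have : (fun y => if x < y then F y else 0) = (Ioi x).indicator F := by
    ext y; simp [indicator]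
  rw [this, setIntegral_indicator measurableSet_Ioi]
  congr 2; ext y; simp only [mem_Ioo, mem_inter_iff, mem_Ioi]; constructor
  · rintro ⟨h1, h2⟩; exact ⟨⟨h.1.trans h1, h2⟩, h1⟩
  · rintro ⟨h1, h2⟩; exact ⟨h2, h1.2⟩

lemma fracInt_eq (s : Side) (β : ℝ) {a b x : ℝ} (hx : x ∈ Ioo a b) (g : ℝ → ℝ) :
    fracInt s β a b g x = (Real.Gamma β)⁻¹ * ∫ y in Ioo a b, kern s β x y * g y := by
  cases s
  · simp only [fracInt, kern]
    rw [setIntegral_Ioo_left hx]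
    congr 2; ext y; split_ifs with h
    · rw [abs_of_pos (sub_pos.2 h)]
    · simp
  · simp only [fracInt, kern]
    rw [setIntegral_Ioo_right hx]
    congr 2; ext y; split_ifs with h
    · rw [abs_sub_comm, abs_of_pos (sub_pos.2 h)]
    · simp

lemma lintegral_riesz_Ioo {β ε : ℝ} (hβ : 0 < β) (hε : 0 < ε) :
    ∫⁻ x in Ioo 0 ε, riesz β x 0 = ENNReal.ofReal (ε ^ β / β) := by
  have hi : IntegrableOn (fun x : ℝ => x ^ (β - 1)) (Ioo 0 ε) :=
    ((intervalIntegral.intervalIntegrable_rpow' (by linarith)).1).mono_set Ioo_subset_Ioc_self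
  have : ∫⁻ x in Ioo 0 ε, riesz β x 0 = ∫⁻ x in Ioo 0 ε, ENNReal.ofReal (x ^ (β - 1)) := by
    refine setLIntegral_congr_fun measurableSet_Ioo fun x hx => ?_
    simp only [riesz, sub_zero, abs_of_pos hx.1]
  rw [this, ← ofReal_integral_eq_lintegral_ofReal hi
    ((ae_restrict_mem measurableSet_Ioo).mono fun x hx => Real.rpow_nonneg hx.1.le _),
    ← integral_Ioc_eq_integral_Ioo, ← intervalIntegral.integral_of_le hε.le,
    integral_rpow (Or.inl (by linarith))]
  simp [Real.zero_rpow hβ.ne']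

lemma lintegral_riesz_ball {β ε : ℝ} (hβ : 0 < β) (hε : 0 < ε) (y : ℝ) :
    ∫⁻ x in Ioo (y - ε) (y + ε), riesz β x y ≤ ENNReal.ofReal (2 / β * ε ^ β) := by
  have h1 : ∫⁻ x in Ioo y (y + ε), riesz β x y = ENNReal.ofReal (ε ^ β / β) := by
    have := (measurePreserving_sub_right volume y).setLIntegral_comp_preimage_emb
      (measurableEmbedding_subRight y) (fun x => riesz β x 0) (Ioo 0 ε)
    rw [← lintegral_riesz_Ioo hβ hε, ← this]
    simp [riesz, add_comm]
  have h2 : ∫⁻ x in Ioo (y - ε) y, riesz β x y = ENNReal.ofReal (ε ^ β / β) := by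
    have := (Measure.measurePreserving_sub_left volume y).setLIntegral_comp_preimage_emb
      (Homeomorph.subLeft y).measurableEmbedding (fun x => riesz β x 0) (Ioo 0 ε)
    rw [← lintegral_riesz_Ioo hβ hε, ← this]
    simp [riesz, abs_sub_comm]
  have hsub : Ioo (y - ε) (y + ε) ⊆ Ioo (y - ε) y ∪ ({y} ∪ Ioo y (y + ε)) := by
    intro x hx
    rcases lt_trichotomy x y with h | h | h
    · exact Or.inl ⟨hx.1, h⟩
    · exact Or.inr (Or.inl h)
    · exact Or.inr (Or.inr ⟨h, hx.2⟩)
  calc _ ≤ _ := lintegral_mono_set hsub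
    _ ≤ _ := (lintegral_union_le _ _ _).trans (add_le_add le_rfl (lintegral_union_le _ _ _))
    _ = ENNReal.ofReal (2 / β * ε ^ β) := by
      rw [h1, h2]
      simp only [Measure.restrict_singleton, Real.volume_singleton, zero_smul,
        lintegral_zero_measure, zero_add]
      rw [← ENNReal.ofReal_add (by positivity) (by positivity)]
      congr 1; ring

/-- The Riesz kernel has small mass on small sets. -/
lemma lintegral_riesz_le {β ε : ℝ} (hβ : 0 < β) (hβ1 : β ≤ 1) (hε : 0 < ε) {L : Set ℝ}
    (hL : volume L ≤ ENNReal.ofReal ε) (y : ℝ) :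
    ∫⁻ x in L, riesz β x y ≤ ENNReal.ofReal ((2 / β + 1) * ε ^ β) := by
  -- Split at distance `ε` from the pole. Inside, the ball integral is `2 / β * ε ^ β`; outside, `β
  -- ≤ 1` bounds the kernel by `ε ^ (β - 1)`, and the measure of `L` supplies the missing factor
  -- `ε`.
  have key : ∀ x, riesz β x y ≤ (Ioo (y - ε) (y + ε)).indicator (fun x => riesz β x y) x
      + ENNReal.ofReal (ε ^ (β - 1)) := by
    intro x
    by_cases hx : x ∈ Ioo (y - ε) (y + ε)
    · rw [indicator_of_mem hx]; exact le_self_add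
    · rw [indicator_of_notMem hx, zero_add]
      refine ENNReal.ofReal_le_ofReal (Real.rpow_le_rpow_of_nonpos hε ?_ (by linarith))
      by_contra! h
      rw [abs_lt] at h
      exact hx ⟨by linarith, by linarith⟩
  calc ∫⁻ x in L, riesz β x y
      ≤ ∫⁻ x in L, ((Ioo (y - ε) (y + ε)).indicator (fun x => riesz β x y) x
        + ENNReal.ofReal (ε ^ (β - 1))) := lintegral_mono key
    _ = (∫⁻ x in L, (Ioo (y - ε) (y + ε)).indicator (fun x => riesz β x y) x)
        + ENNReal.ofReal (ε ^ (β - 1)) * volume L := by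
      rw [lintegral_add_right _ measurable_const]; simp
    _ ≤ ENNReal.ofReal (2 / β * ε ^ β) + ENNReal.ofReal (ε ^ (β - 1)) * ENNReal.ofReal ε := by
      refine add_le_add ?_ (by gcongr)
      refine (setLIntegral_le_lintegral _ _).trans ?_
      rw [lintegral_indicator measurableSet_Ioo]
      exact lintegral_riesz_ball hβ hε y
    _ = _ := by
      rw [← ENNReal.ofReal_mul (by positivity),
        ← ENNReal.ofReal_add (by positivity) (by positivity)]
      congr 1
      rw [← Real.rpow_add_one hε.ne']; ring_nf

/-- The exponents of the scaled Beta integral add up to zero, so the length `d` drops out and `Γ(α +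
(1 - α)) = 1`. -/
lemma integral_beta {α d : ℝ} (h0 : 0 < α) (h1 : α < 1) (hd : 0 < d) :
    ∫ x in (0 : ℝ)..d, x ^ (α - 1) * (d - x) ^ (1 - α - 1) = Real.Gamma α * Real.Gamma (1 - α) := by
  have h := Complex.betaIntegral_scaled (α : ℂ) ((1 - α : ℝ) : ℂ) hd
  rw [Complex.betaIntegral_eq_Gamma_mul_div _ _ (by simpa) (by rw [Complex.ofReal_re]; linarith),
    ← Complex.ofReal_add] at h
  simp only [add_sub_cancel, Complex.ofReal_one, sub_self, Complex.cpow_zero, one_mul,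
    Complex.Gamma_one, div_one, Complex.Gamma_ofReal] at h
  rw [← Complex.ofReal_inj, Complex.ofReal_mul, ← h, ← intervalIntegral.integral_ofReal]
  refine intervalIntegral.integral_congr fun x hx => ?_
  rw [uIcc_of_le hd.le] at hx
  simp only [Complex.ofReal_mul]
  rw [Complex.ofReal_cpow hx.1, Complex.ofReal_cpow (sub_nonneg.2 hx.2)]
  push_cast; rfl

/-- The Beta integral: the kernels of orders `α` and `1 - α` compose to that of order `1`. -/
lemma integral_kern_mul_kern (s : Side) {α a b x y : ℝ} (h0 : 0 < α) (h1 : α < 1)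
    (hx : x ∈ Icc a b) (hy : y ∈ Icc a b) :
    ∫ t in Ioo a b, kern s α x t * kern s (1 - α) t y
      = Real.Gamma α * Real.Gamma (1 - α) * kern s 1 x y := by
  -- Transposing both kernels turns the right case into the left one with `α` and `1 - α`, and `x`
  -- and `y`, exchanged.
  wlog hs : s = .left generalizing s α x y
  · obtain rfl : s = .right := by cases s <;> simp_all
    have := this .left (α := 1 - α) (by linarith) (by linarith) hy hx rfl
    rw [sub_sub_cancel] at this
    rw [show Side.right = Side.left.opp from rfl]
    simp_rw [kern_opp]
    simp_rw [mul_comm (kern Side.left α _ x)]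
    rw [this]; ring
  subst hs
  rcases lt_or_ge y x with h | h
  · have e : ∀ t, kern .left α x t * kern .left (1 - α) t y
        = (Ioo y x).indicator (fun t => (x - t) ^ (α - 1) * (t - y) ^ (1 - α - 1)) t := by
      intro t
      simp only [kern, indicator, mem_Ioo]
      by_cases h1 : y < t <;> by_cases h2 : t < x <;> simp [h1, h2, abs_of_pos]
    simp_rw [e]
    rw [setIntegral_indicator measurableSet_Ioo, inter_eq_self_of_subset_right
      (Ioo_subset_Ioo hy.1 hx.2), ← integral_Ioc_eq_integral_Ioo,
      ← intervalIntegral.integral_of_le h.le]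
    -- The substitution of `x - t` for `t` carries the interval from `y` to `x` to the one from `0`
    -- to `x - y` of the Beta integral.
    have := intervalIntegral.integral_comp_sub_left (a := y) (b := x)
      (fun t => t ^ (α - 1) * ((x - y) - t) ^ (1 - α - 1)) x
    simp only [sub_self] at this
    rw [integral_beta h0 h1 (sub_pos.2 h)] at this
    simp only [kern, h, if_true, sub_self, Real.rpow_zero, mul_one]
    rw [← this]
    congr 1; ext t; congr 2; ring
  · have e : ∀ t, kern .left α x t * kern .left (1 - α) t y = 0 := by
      intro t
      simp only [kern]
      by_cases h1 : y < t <;> by_cases h2 : t < x <;> simp [h1, h2]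
      linarith
    simp_rw [e]
    simp [kern, not_lt.2 h]

/-! ### Fractional integrals: duality and composition -/

/-- Bounded measurable functions on `(a, b)`. -/
def BddMeas (a b : ℝ) (g : ℝ → ℝ) : Prop :=
  AEStronglyMeasurable g (volume.restrict (Ioo a b)) ∧ ∃ C, ∀ x ∈ Ioo a b, |g x| ≤ C

lemma BddMeas.integrableOn {a b : ℝ} {g : ℝ → ℝ} (hg : BddMeas a b g) :
    IntegrableOn g (Ioo a b) := by
  obtain ⟨hm, C, hC⟩ := hg
  exact Integrable.of_bound hm C ((ae_restrict_mem measurableSet_Ioo).mono fun x hx => hC x hx)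

lemma BddMeas.memLp {a b : ℝ} {g : ℝ → ℝ} (hg : BddMeas a b g) (p : ℝ≥0∞) :
    MemLp g p (volume.restrict (Ioo a b)) := by
  obtain ⟨hm, C, hC⟩ := hg
  exact MemLp.of_bound hm C ((ae_restrict_mem measurableSet_Ioo).mono fun x hx => hC x hx)

lemma IntegrableOn.mul_bddMeas {a b : ℝ} {u g : ℝ → ℝ} (hu : IntegrableOn u (Ioo a b))
    (hg : BddMeas a b g) : IntegrableOn (fun x => u x * g x) (Ioo a b) := by
  obtain ⟨hm, C, hC⟩ := hg
  exact hu.mul_bdd hm ((ae_restrict_mem measurableSet_Ioo).mono fun x hx => hC x hx)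

lemma exists_lintegral_riesz_le {β : ℝ} (hβ : 0 < β) (hβ1 : β ≤ 1) (a b : ℝ) :
    ∃ K : ℝ, ∀ y, ∫⁻ x in Ioo a b, riesz β x y ≤ ENNReal.ofReal K := by
  rcases lt_or_ge a b with h | h
  · exact ⟨_, lintegral_riesz_le hβ hβ1 (sub_pos.2 h) (by simp)⟩
  · exact ⟨0, by simp [Ioo_eq_empty (not_lt.2 h)]⟩

/-- Integrating first in the variable of the bounded factor leaves the kernel mass, bounded
uniformly in the pole, so the other factor need only be integrable. -/
lemma integrable_kern_prod (s : Side) {β a b : ℝ} (hβ : 0 < β) (hβ1 : β ≤ 1) {u g : ℝ → ℝ}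
    (hu : IntegrableOn u (Ioo a b)) (hg : BddMeas a b g) :
    Integrable (fun z : ℝ × ℝ => u z.1 * (kern s β z.1 z.2 * g z.2))
      ((volume.restrict (Ioo a b)).prod (volume.restrict (Ioo a b))) := by
  obtain ⟨hgm, C, hC⟩ := hg
  obtain ⟨K, hK⟩ := exists_lintegral_riesz_le hβ hβ1 a b
  have hm : AEStronglyMeasurable (fun z : ℝ × ℝ => u z.1 * (kern s β z.1 z.2 * g z.2))
      ((volume.restrict (Ioo a b)).prod (volume.restrict (Ioo a b))) :=
    hu.aestronglyMeasurable.comp_fst.mul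
      ((measurable_kern s β).aestronglyMeasurable.mul hgm.comp_snd)
  refine ⟨hm, ?_⟩
  rw [HasFiniteIntegral, lintegral_prod _ hm.enorm]
  calc _ ≤ ∫⁻ x in Ioo a b, ‖u x‖ₑ * (ENNReal.ofReal K * ENNReal.ofReal C) := by
        refine lintegral_mono fun x => ?_
        calc ∫⁻ y in Ioo a b, ‖u x * (kern s β x y * g y)‖ₑ
            ≤ ∫⁻ y in Ioo a b, ‖u x‖ₑ * (riesz β y x * ENNReal.ofReal C) := by
              refine setLIntegral_mono' measurableSet_Ioo fun y hy => ?_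
              rw [enorm_mul, enorm_mul]
              gcongr
              · rw [riesz_comm]; exact enorm_kern_le ..
              · rw [Real.enorm_eq_ofReal_abs]; exact ENNReal.ofReal_le_ofReal (hC y hy)
          _ ≤ _ := by
              rw [lintegral_const_mul' _ _ (by simp), lintegral_mul_const' _ _ (by simp)]
              gcongr
              exact hK x
    _ < ⊤ := by
      rw [lintegral_mul_const' _ _ (by finiteness)]
      exact ENNReal.mul_lt_top hu.2 (by finiteness)

lemma integrableOn_fracInt (s : Side) {β a b : ℝ} (hβ : 0 < β) (hβ1 : β ≤ 1) {g : ℝ → ℝ}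
    (hg : IntegrableOn g (Ioo a b)) : IntegrableOn (fracInt s β a b g) (Ioo a b) := by
  have h1 : BddMeas a b (fun _ => 1) := ⟨aestronglyMeasurable_const, 1, by simp⟩
  -- With the constant `1` as bounded factor, integrating out one variable leaves the fractional
  -- integral of `g`, up to normalisation.
  have h := ((integrable_kern_prod s.opp hβ hβ1 hg h1).swap.integral_prod_left).const_mul
    (Real.Gamma β)⁻¹
  refine IntegrableOn.congr_fun h (fun x hx => ?_) measurableSet_Ioo
  rw [fracInt_eq s β hx]
  simp [kern_opp, mul_comm]

lemma BddMeas.fracInt (s : Side) {β a b : ℝ} (hβ : 0 < β) (hβ1 : β ≤ 1) {g : ℝ → ℝ}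
    (hg : BddMeas a b g) : BddMeas a b (fracInt s β a b g) := by
  refine ⟨(integrableOn_fracInt s hβ hβ1 hg.integrableOn).aestronglyMeasurable, ?_⟩
  obtain ⟨hgm, C, hC⟩ := hg
  obtain ⟨K, hK⟩ := exists_lintegral_riesz_le hβ hβ1 a b
  refine ⟨|(Real.Gamma β)⁻¹| * (ENNReal.ofReal K * ENNReal.ofReal C).toReal, fun x hx => ?_⟩
  rw [fracInt_eq s β hx, abs_mul]
  gcongr
  rw [← Real.norm_eq_abs]
  refine (norm_integral_le_lintegral_norm _).trans (ENNReal.toReal_mono (by finiteness) ?_)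
  rw [← ENNReal.ofReal_toReal (a := ENNReal.ofReal C) (by simp)]
  refine le_trans ?_ (mul_le_mul_left (hK x) _)
  rw [← lintegral_mul_const' _ _ (by simp)]
  refine setLIntegral_mono' measurableSet_Ioo fun y hy => ?_
  rw [ofReal_norm, enorm_mul]
  gcongr
  · rw [riesz_comm]; exact enorm_kern_le ..
  · rw [Real.enorm_eq_ofReal_abs, ENNReal.ofReal_toReal (by simp)]
    exact ENNReal.ofReal_le_ofReal (hC y hy)

/-- Fractional integration by parts. -/
lemma integral_mul_fracInt (s : Side) {β a b : ℝ} (hβ : 0 < β) (hβ1 : β ≤ 1) {u g : ℝ → ℝ}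
    (hu : IntegrableOn u (Ioo a b)) (hg : BddMeas a b g) :
    ∫ x in Ioo a b, u x * fracInt s β a b g x = ∫ x in Ioo a b, fracInt s.opp β a b u x * g x := by
  have h1 : ∫ x in Ioo a b, u x * fracInt s β a b g x
      = (Real.Gamma β)⁻¹ * ∫ x in Ioo a b, ∫ y in Ioo a b, u x * (kern s β x y * g y) := by
    rw [← integral_const_mul]
    refine setIntegral_congr_fun measurableSet_Ioo fun x hx => ?_
    rw [fracInt_eq s β hx, integral_const_mul]; ring
  have h2 : ∫ x in Ioo a b, fracInt s.opp β a b u x * g x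
      = (Real.Gamma β)⁻¹ * ∫ y in Ioo a b, ∫ x in Ioo a b, u x * (kern s β x y * g y) := by
    rw [← integral_const_mul]
    refine setIntegral_congr_fun measurableSet_Ioo fun x hx => ?_
    rw [fracInt_eq _ β hx, mul_assoc, ← integral_mul_const]
    congr 2; ext y
    rw [kern_opp]; ring
  rw [h1, h2, integral_integral_swap (integrable_kern_prod s hβ hβ1 hu hg)]

lemma integral_fracInt_mul (s : Side) {β a b : ℝ} (hβ : 0 < β) (hβ1 : β ≤ 1) {u g : ℝ → ℝ}
    (hu : IntegrableOn u (Ioo a b)) (hg : BddMeas a b g) :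
    ∫ x in Ioo a b, fracInt s β a b u x * g x = ∫ x in Ioo a b, u x * fracInt s.opp β a b g x := by
  rw [integral_mul_fracInt _ hβ hβ1 hu hg, Side.opp_opp]

lemma integrableOn_kern (s : Side) {β : ℝ} (hβ : 0 < β) (hβ1 : β ≤ 1) (a b x : ℝ) :
    IntegrableOn (fun t => kern s β t x) (Ioo a b) := by
  obtain ⟨K, hK⟩ := exists_lintegral_riesz_le hβ hβ1 a b
  refine ⟨((measurable_kern s β).comp (measurable_id.prodMk measurable_const)).aestronglyMeasurable,
    ?_⟩
  exact (lintegral_mono fun t => enorm_kern_le s β t x).trans_lt ((hK x).trans_lt (by simp))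

/-- Composition of fractional integrals of complementary orders, on bounded functions. -/
lemma fracInt_fracInt (s : Side) {α a b x : ℝ} (h0 : 0 < α) (h1 : α < 1) {g : ℝ → ℝ}
    (hg : BddMeas a b g) (hx : x ∈ Ioo a b) :
    fracInt s α a b (fracInt s (1 - α) a b g) x = fracInt s 1 a b g x := by
  have hk : IntegrableOn (fun t => kern s α x t) (Ioo a b) := by
    simpa only [kern_opp] using integrableOn_kern s.opp h0 h1.le a b x
  -- The outer kernel plays the role of the integrable factor: integration by parts moves the inner
  -- integral onto it and the Beta integral evaluates the result. Boundedness of `g` gives this at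
  -- every `x`, not only almost everywhere.
  rw [fracInt_eq s α hx, integral_mul_fracInt s (by linarith) (by linarith) hk hg,
    fracInt_eq s 1 hx, Real.Gamma_one, inv_one, one_mul, ← integral_const_mul]
  refine setIntegral_congr_fun measurableSet_Ioo fun y hy => ?_
  rw [fracInt_eq _ _ hy]
  have := integral_kern_mul_kern s h0 h1 (Ioo_subset_Icc_self hx) (Ioo_subset_Icc_self hy)
  simp_rw [kern_opp, mul_comm (kern s (1 - α) _ _)]
  rw [this]
  have h3 := (Real.Gamma_pos_of_pos h0).ne'
  have h4 := (Real.Gamma_pos_of_pos (sub_pos.2 h1)).ne'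
  field_simp

lemma fracInt_fracInt' (s : Side) {α a b x : ℝ} (h0 : 0 < α) (h1 : α < 1) {g : ℝ → ℝ}
    (hg : BddMeas a b g) (hx : x ∈ Ioo a b) :
    fracInt s (1 - α) a b (fracInt s α a b g) x = fracInt s 1 a b g x := by
  have := fracInt_fracInt s (α := 1 - α) (by linarith) (by linarith) hg hx
  rwa [sub_sub_cancel] at this

lemma fracInt_congr (s : Side) (β : ℝ) {a b x : ℝ} {g h : ℝ → ℝ}
    (hgh : g =ᵐ[volume.restrict (Ioo a b)] h) (hx : x ∈ Ioo a b) :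
    fracInt s β a b g x = fracInt s β a b h x := by
  rw [fracInt_eq s β hx, fracInt_eq s β hx]
  congr 1
  exact integral_congr_ae (hgh.mono fun y hy => by simp only [hy])

/-! ### Test functions -/

/-- The derivative in direction `s`. -/
def sder (s : Side) (φ : ℝ → ℝ) (x : ℝ) : ℝ :=
  match s with
  | .left => deriv φ x
  | .right => -deriv φ x

lemma testDeriv_eq (s : Side) (α a b : ℝ) (φ : ℝ → ℝ) :
    testDeriv s α a b φ = fracInt s (1 - α) a b (sder s φ) := by
  cases s <;> rfl

lemma bddMeas_of_continuous {a b : ℝ} {g : ℝ → ℝ} (hg : Continuous g) : BddMeas a b g := by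
  refine ⟨hg.aestronglyMeasurable, ?_⟩
  obtain ⟨C, hC⟩ := isCompact_Icc.exists_bound_of_continuousOn (s := Icc a b) hg.continuousOn
  exact ⟨C, fun x hx => hC x (Ioo_subset_Icc_self hx)⟩

lemma IsTest.bddMeas {a b : ℝ} {φ : ℝ → ℝ} (h : IsTest a b φ) : BddMeas a b φ :=
  bddMeas_of_continuous h.1.continuous

lemma IsTest.bddMeas_sder {a b : ℝ} {φ : ℝ → ℝ} (h : IsTest a b φ) (s : Side) :
    BddMeas a b (sder s φ) := by
  have := h.1.continuous_deriv (by simp)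
  cases s
  · exact bddMeas_of_continuous this
  · exact bddMeas_of_continuous this.neg

lemma IsTest.eq_zero {a b x : ℝ} {φ : ℝ → ℝ} (h : IsTest a b φ) (hx : x ∉ Ioo a b) : φ x = 0 := by
  by_contra h1
  exact hx (h.2.2 (subset_tsupport _ h1))

lemma fracInt_one_left {a b x : ℝ} (g : ℝ → ℝ) :
    fracInt .left 1 a b g x = ∫ y in Ioo a x, g y := by
  simp [fracInt]

lemma fracInt_one_right {a b x : ℝ} (g : ℝ → ℝ) :
    fracInt .right 1 a b g x = ∫ y in Ioo x b, g y := by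
  simp [fracInt]

lemma IsTest.integral_deriv {a b c d : ℝ} {φ : ℝ → ℝ} (h : IsTest a b φ) (hcd : c ≤ d) :
    ∫ y in Ioo c d, deriv φ y = φ d - φ c := by
  rw [← integral_Ioc_eq_integral_Ioo, ← intervalIntegral.integral_of_le hcd]
  refine intervalIntegral.integral_deriv_eq_sub
    (fun x _ => (h.1.differentiable (by simp)).differentiableAt) ?_
  exact (h.1.continuous_deriv (by simp)).intervalIntegrable _ _

/-- The sign in `sder` is chosen so that the fundamental theorem of calculus reads the same in both
directions. -/
lemma IsTest.fracInt_one_sder {a b x : ℝ} {φ : ℝ → ℝ} (h : IsTest a b φ) (s : Side)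
    (hx : x ∈ Ioo a b) : fracInt s 1 a b (sder s φ) x = φ x := by
  cases s
  · rw [fracInt_one_left]
    simp only [sder]
    rw [h.integral_deriv hx.1.le, h.eq_zero (x := a) (by simp), sub_zero]
  · rw [fracInt_one_right]
    simp only [sder]
    rw [integral_neg, h.integral_deriv hx.2.le, h.eq_zero (x := b) (by simp)]
    simp

/-- The fundamental lemma of the calculus of variations on `(a, b)`. -/
lemma ae_eq_zero_of_forall_isTest {a b : ℝ} {F : ℝ → ℝ} (hF : LocallyIntegrableOn F (Ioo a b))
    (h : ∀ φ, IsTest a b φ → ∫ x in Ioo a b, F x * φ x = 0) :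
    F =ᵐ[volume.restrict (Ioo a b)] 0 := by
  rw [Filter.EventuallyEq, ae_restrict_iff' measurableSet_Ioo]
  refine isOpen_Ioo.ae_eq_zero_of_integral_contDiff_smul_eq_zero hF fun g h1 h2 h3 => ?_
  rw [← h g ⟨h1, h2, h3⟩, ← integral_indicator measurableSet_Ioo]
  congr 1; ext x
  by_cases hx : x ∈ Ioo a b
  · simp [hx, mul_comm]
  · simp [hx, IsTest.eq_zero ⟨h1, h2, h3⟩ hx]

lemma IsTest.integrableOn_mul {a b : ℝ} {F φ : ℝ → ℝ} (hφ : IsTest a b φ)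
    (hF : LocallyIntegrableOn F (Ioo a b)) : IntegrableOn (fun x => F x * φ x) (Ioo a b) := by
  have h1 : IntegrableOn (fun x => F x * φ x) (tsupport φ) :=
    (hF.integrableOn_compact_subset hφ.2.2 hφ.2.1).mul_continuousOn
      hφ.1.continuous.continuousOn hφ.2.1
  have h2 : Integrable (fun x => F x * φ x) := by
    refine (integrableOn_iff_integrable_of_support_subset ?_).1 h1
    intro x hx
    exact subset_tsupport φ (right_ne_zero_of_mul hx)
  exact h2.integrableOn

lemma ae_eq_of_forall_isTest {a b : ℝ} {F G : ℝ → ℝ} (hF : LocallyIntegrableOn F (Ioo a b))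
    (hG : LocallyIntegrableOn G (Ioo a b))
    (h : ∀ φ, IsTest a b φ → ∫ x in Ioo a b, F x * φ x = ∫ x in Ioo a b, G x * φ x) :
    F =ᵐ[volume.restrict (Ioo a b)] G := by
  have := ae_eq_zero_of_forall_isTest (hF.sub hG) fun φ hφ => by
    simp only [Pi.sub_apply, sub_mul]
    rw [integral_sub (hφ.integrableOn_mul hF) (hφ.integrableOn_mul hG), h φ hφ, sub_self]
  exact this.mono fun x hx => by simpa [sub_eq_zero] using hx

/-! ### Weak fractional derivatives -/

lemma IsWeakDeriv.ae_unique {s : Side} {α a b : ℝ} {u w z : ℝ → ℝ} (hw : IsWeakDeriv s α a b u w)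
    (hz : IsWeakDeriv s α a b u z) : w =ᵐ[volume.restrict (Ioo a b)] z :=
  ae_eq_of_forall_isTest hw.2.1 hz.2.1 fun φ hφ => (hw.2.2 φ hφ).trans (hz.2.2 φ hφ).symm

lemma IsWeakDeriv.isWeakDeriv_weakDeriv {s : Side} {α a b : ℝ} {u w : ℝ → ℝ}
    (hw : IsWeakDeriv s α a b u w) : IsWeakDeriv s α a b u (weakDeriv s α a b u) := by
  have h : ∃ w, IsWeakDeriv s α a b u w := ⟨w, hw⟩
  rw [weakDeriv, dif_pos h]
  exact h.choose_spec

lemma IsWeakDeriv.weakDeriv_ae_eq {s : Side} {α a b : ℝ} {u w : ℝ → ℝ}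
    (hw : IsWeakDeriv s α a b u w) : weakDeriv s α a b u =ᵐ[volume.restrict (Ioo a b)] w :=
  hw.isWeakDeriv_weakDeriv.ae_unique hw

lemma IsWeakDeriv.congr {s : Side} {α a b : ℝ} {u v w : ℝ → ℝ}
    (hw : IsWeakDeriv s α a b u w) (h : u =ᵐ[volume.restrict (Ioo a b)] v) :
    IsWeakDeriv s α a b v w := by
  refine ⟨Integrable.congr hw.1 h, hw.2.1, fun φ hφ => (hw.2.2 φ hφ).trans ?_⟩
  exact integral_congr_ae (h.mono fun x hx => by simp only [hx])

lemma IsTest.bddMeas_testDeriv {a b : ℝ} {φ : ℝ → ℝ} (h : IsTest a b φ) (s : Side) {α : ℝ}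
    (h0 : 0 < α) (h1 : α < 1) : BddMeas a b (testDeriv s α a b φ) := by
  rw [testDeriv_eq]
  exact (h.bddMeas_sder s).fracInt s (by linarith) (by linarith)

lemma IsWeakDeriv.add_mul {s : Side} {α a b : ℝ} (h0 : 0 < α) (h1 : α < 1) {u v w z : ℝ → ℝ}
    (hu : IsWeakDeriv s α a b u w) (hv : IsWeakDeriv s α a b v z) (t : ℝ) :
    IsWeakDeriv s α a b (fun x => u x + t * v x) (fun x => w x + t * z x) := by
  refine ⟨hu.1.add (hv.1.const_mul t), hu.2.1.add (hv.2.1.smul t), fun φ hφ => ?_⟩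
  have hb := hφ.bddMeas_testDeriv s.opp h0 h1
  simp only [_root_.add_mul, mul_assoc]
  rw [integral_add (hφ.integrableOn_mul hu.2.1) ((hφ.integrableOn_mul hv.2.1).const_mul t),
    integral_add (IntegrableOn.mul_bddMeas hu.1 hb)
      ((IntegrableOn.mul_bddMeas hv.1 hb).const_mul t),
    integral_const_mul, integral_const_mul, hu.2.2 φ hφ, hv.2.2 φ hφ]

/-- Moving `I^α` onto the derivative of the test function produces `I^α I^{1-α}` of its signed
derivative, which is the test function itself. -/
lemma isWeakDeriv_fracInt (s : Side) {α a b : ℝ} (h0 : 0 < α) (h1 : α < 1) {h : ℝ → ℝ}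
    (hh : IntegrableOn h (Ioo a b)) : IsWeakDeriv s α a b (fracInt s α a b h) h := by
  refine ⟨integrableOn_fracInt s h0 h1.le hh, IntegrableOn.locallyIntegrableOn hh, fun φ hφ => ?_⟩
  rw [testDeriv_eq, integral_fracInt_mul s h0 h1.le hh
    ((hφ.bddMeas_sder s.opp).fracInt _ (by linarith) (by linarith))]
  refine setIntegral_congr_fun measurableSet_Ioo fun x hx => ?_
  rw [fracInt_fracInt s.opp h0 h1 (hφ.bddMeas_sder s.opp) hx, hφ.fracInt_one_sder _ hx]

/-- A test function is `I^α` of its classical fractional derivative, so the case of fractional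
integrals applies. -/
lemma IsTest.isWeakDeriv {a b : ℝ} {φ : ℝ → ℝ} (hφ : IsTest a b φ) (s : Side) {α : ℝ}
    (h0 : 0 < α) (h1 : α < 1) : IsWeakDeriv s α a b φ (testDeriv s α a b φ) := by
  have := isWeakDeriv_fracInt s h0 h1 (hφ.bddMeas_testDeriv s h0 h1).integrableOn
  refine this.congr ((ae_restrict_mem measurableSet_Ioo).mono fun x hx => ?_)
  rw [testDeriv_eq, fracInt_fracInt s h0 h1 (hφ.bddMeas_sder s) hx, hφ.fracInt_one_sder _ hx]

lemma startFilter_le_nhdsWithin {s : Side} {a b : ℝ} (hab : a < b) :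
    startFilter s a b ≤ 𝓝[Ioo a b] (startPt s a b) := by
  cases s
  · exact inf_le_left.trans (nhdsWithin_Ioo_eq_nhdsGT hab).ge
  · exact inf_le_left.trans (nhdsWithin_Ioo_eq_nhdsLT hab).ge

lemma eventually_startFilter_mem {s : Side} {a b : ℝ} (hab : a < b) :
    ∀ᶠ x in startFilter s a b, x ∈ Ioo a b :=
  startFilter_le_nhdsWithin hab self_mem_nhdsWithin

/-- The points of `(a, b)` where integration in direction `s` up to `x` takes place. -/
def cut (s : Side) (a b x : ℝ) : Set ℝ :=
  match s with
  | .left => Ioo a x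
  | .right => Ioo x b

lemma measurableSet_cut (s : Side) (a b x : ℝ) : MeasurableSet (cut s a b x) := by
  cases s <;> exact measurableSet_Ioo

lemma tendsto_volume_cut (s : Side) (a b : ℝ) :
    Tendsto (fun x => volume (cut s a b x)) (𝓝 (startPt s a b)) (𝓝 0) := by
  cases s
  · simp only [cut, startPt, Real.volume_Ioo]
    have : Tendsto (fun x : ℝ => ENNReal.ofReal (x - a)) (𝓝 a) (𝓝 (ENNReal.ofReal (a - a))) :=
      (ENNReal.continuous_ofReal.comp (by fun_prop : Continuous fun x : ℝ => x - a)).tendsto a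
    simpa using this
  · simp only [cut, startPt, Real.volume_Ioo]
    have : Tendsto (fun x : ℝ => ENNReal.ofReal (b - x)) (𝓝 b) (𝓝 (ENNReal.ofReal (b - b))) :=
      (ENNReal.continuous_ofReal.comp (by fun_prop : Continuous fun x : ℝ => b - x)).tendsto b
    simpa using this

lemma cut_subset {s : Side} {a b x : ℝ} (hx : x ∈ Ioo a b) : cut s a b x ⊆ Ioo a b := by
  cases s
  · exact Ioo_subset_Ioo_right hx.2.le
  · exact Ioo_subset_Ioo_left hx.1.le

/-- Absolute continuity of the integral: the domain of integration shrinks to length zero. -/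
lemma tendsto_fracInt_one (s : Side) {a b : ℝ} (hab : a < b) {g : ℝ → ℝ}
    (hg : IntegrableOn g (Ioo a b)) :
    Tendsto (fracInt s 1 a b g) (startFilter s a b) (𝓝 0) := by
  have h1 : Tendsto (fun x => ∫ y in cut s a b x, g y ∂(volume.restrict (Ioo a b)))
      (startFilter s a b) (𝓝 0) := by
    refine Integrable.tendsto_setIntegral_nhds_zero hg ?_
    refine tendsto_of_tendsto_of_tendsto_of_le_of_le tendsto_const_nhds
      ((tendsto_volume_cut s a b).mono_left ((startFilter_le_nhdsWithin hab).trans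
        nhdsWithin_le_nhds)) (fun _ => zero_le) fun x => Measure.restrict_apply_le _ _
  refine h1.congr' ((eventually_startFilter_mem hab).mono fun x hx => ?_)
  rw [Measure.restrict_restrict_of_subset (cut_subset hx)]
  cases s
  · rw [fracInt_one_left]; rfl
  · rw [fracInt_one_right]; rfl

lemma BddMeas.fracInt_mem_oneSidedSobolev {a b : ℝ} {h : ℝ → ℝ} (hh : BddMeas a b h) (s : Side)
    {α : ℝ} (h0 : 0 < α) (h1 : α < 1) (p : ℝ) :
    FracVar.fracInt s α a b h ∈ oneSidedSobolev s α p a b :=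
  ⟨(hh.fracInt s h0 h1.le).memLp _, h, isWeakDeriv_fracInt s h0 h1 hh.integrableOn, hh.memLp _⟩

/-- Since `I^{1-α} I^α h = I^1 h`, the essential boundary condition is automatic. This supplies the
variations that identify the Neumann flux in the one-sided cases. -/
lemma BddMeas.fracInt_mem_ringSobolev {a b : ℝ} (hab : a < b) {h : ℝ → ℝ} (hh : BddMeas a b h)
    (s : Side) {α : ℝ} (h0 : 0 < α) (h1 : α < 1) (p : ℝ) :
    FracVar.fracInt s α a b h ∈ ringSobolev s α p a b := by
  refine ⟨hh.fracInt_mem_oneSidedSobolev s h0 h1 p, ?_⟩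
  refine (tendsto_fracInt_one s hab hh.integrableOn).congr'
    ((eventually_startFilter_mem hab).mono fun x hx => ?_)
  rw [fracInt_fracInt' s h0 h1 hh hx]

lemma oneSidedSobolev_congr {s : Side} {α p a b : ℝ} {u v : ℝ → ℝ}
    (hu : u ∈ oneSidedSobolev s α p a b) (h : u =ᵐ[volume.restrict (Ioo a b)] v) :
    v ∈ oneSidedSobolev s α p a b := by
  obtain ⟨h1, w, hw, hp⟩ := hu
  exact ⟨h1.ae_eq h, w, hw.congr h, hp⟩

lemma ringSobolev_congr {s : Side} {α p a b : ℝ} (hab : a < b) {u v : ℝ → ℝ}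
    (hu : u ∈ ringSobolev s α p a b) (h : u =ᵐ[volume.restrict (Ioo a b)] v) :
    v ∈ ringSobolev s α p a b :=
  ⟨oneSidedSobolev_congr hu.1 h, hu.2.congr'
    ((eventually_startFilter_mem hab).mono fun _ hx => fracInt_congr s _ h hx)⟩

lemma IsTest.mem_ringSobolev {a b : ℝ} (hab : a < b) {φ : ℝ → ℝ} (hφ : IsTest a b φ) (s : Side)
    {α : ℝ} (h0 : 0 < α) (h1 : α < 1) (p : ℝ) : φ ∈ ringSobolev s α p a b := by
  refine ringSobolev_congr hab
    ((hφ.bddMeas_testDeriv s h0 h1).fracInt_mem_ringSobolev hab s h0 h1 p)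
    ((ae_restrict_mem measurableSet_Ioo).mono fun x hx => ?_)
  rw [testDeriv_eq, fracInt_fracInt s h0 h1 (hφ.bddMeas_sder s) hx, hφ.fracInt_one_sder _ hx]

/-! ### Functions with vanishing weak derivative -/

lemma exists_isTest_integral_eq_one {a b : ℝ} (hab : a < b) :
    ∃ χ, IsTest a b χ ∧ ∫ x in Ioo a b, χ x = 1 := by
  let f : ContDiffBump ((a + b) / 2) := ⟨(b - a) / 8, (b - a) / 4, by linarith, by linarith⟩
  have ht : IsTest a b (f.normed volume) := by
    refine ⟨f.contDiff_normed, f.hasCompactSupport_normed, ?_⟩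
    rw [f.tsupport_normed_eq, Real.closedBall_eq_Icc]
    intro x hx
    exact ⟨by have := hx.1; simp only [f] at this; linarith,
      by have := hx.2; simp only [f] at this; linarith⟩
  refine ⟨_, ht, ?_⟩
  rw [← f.integral_normed (μ := volume)]
  exact setIntegral_eq_integral_of_forall_compl_eq_zero fun x hx => ht.eq_zero hx

lemma exists_Icc_of_isCompact {a b : ℝ} (hab : a < b) {K : Set ℝ} (hK : IsCompact K)
    (h : K ⊆ Ioo a b) : ∃ c d, a < c ∧ d < b ∧ K ⊆ Icc c d := by
  have hne : (insert ((a + b) / 2) K).Nonempty := ⟨_, mem_insert _ _⟩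
  have hs : insert ((a + b) / 2) K ⊆ Ioo a b := by
    rintro x (rfl | hx)
    · exact ⟨by linarith, by linarith⟩
    · exact h hx
  obtain ⟨c, hc⟩ := (hK.insert ((a + b) / 2)).exists_isLeast hne
  obtain ⟨d, hd⟩ := (hK.insert ((a + b) / 2)).exists_isGreatest hne
  exact ⟨c, d, (hs hc.1).1, (hs hd.1).2, fun x hx =>
    ⟨hc.2 (mem_insert_of_mem _ hx), hd.2 (mem_insert_of_mem _ hx)⟩⟩

/-- The primitive from `a` vanishes to the left of the support of `ζ`; mean zero makes it vanish to
the right as well. -/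
lemma IsTest.exists_antideriv {a b : ℝ} (hab : a < b) {ζ : ℝ → ℝ} (hζ : IsTest a b ζ)
    (h : ∫ x in Ioo a b, ζ x = 0) : ∃ φ, IsTest a b φ ∧ deriv φ = ζ := by
  have hc := hζ.1.continuous
  have hd : ∀ x, HasDerivAt (fun x => ∫ y in a..x, ζ y) (ζ x) x := fun x =>
    intervalIntegral.integral_hasDerivAt_right (hc.intervalIntegrable _ _)
      (hc.stronglyMeasurableAtFilter _ _) hc.continuousAt
  have hderiv : deriv (fun x => ∫ y in a..x, ζ y) = ζ := funext fun x => (hd x).deriv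
  obtain ⟨c, d, hac, hdb, hK⟩ := exists_Icc_of_isCompact hab hζ.2.1 hζ.2.2
  have hz : ∀ x, x ∉ Icc c d → ζ x = 0 := fun x hx => by
    by_contra h1
    exact hx (hK (subset_tsupport _ h1))
  have hsupp : tsupport (fun x => ∫ y in a..x, ζ y) ⊆ Icc c d := by
    refine closure_minimal (fun x hx => ?_) isClosed_Icc
    by_contra hn
    refine hx ?_
    rw [mem_Icc, not_and_or, not_le, not_le] at hn
    rcases hn with hn | hn
    · refine intervalIntegral.integral_zero_ae (Eventually.of_forall fun y hy => hz y fun hy' => ?_)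
      rcases mem_uIoc.1 hy with h1 | h1
      · linarith [hy'.1, h1.2]
      · linarith [hy'.1, h1.2]
    · have h1 : ∫ y in a..b, ζ y = 0 := by
        rwa [intervalIntegral.integral_of_le hab.le, integral_Ioc_eq_integral_Ioo]
      have h2 : ∫ y in x..b, ζ y = 0 := by
        refine intervalIntegral.integral_zero_ae
          (Eventually.of_forall fun y hy => hz y fun hy' => ?_)
        rcases mem_uIoc.1 hy with h1 | h1
        · linarith [hy'.2, h1.1]
        · linarith [hy'.2, h1.1]
      have h3 := intervalIntegral.integral_add_adjacent_intervals
        (hc.intervalIntegrable a x (μ := volume)) (hc.intervalIntegrable x b)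
      beta_reduce
      linarith
  refine ⟨_, ⟨?_, HasCompactSupport.of_support_subset_isCompact isCompact_Icc
    ((subset_tsupport _).trans hsupp), hsupp.trans (Icc_subset_Ioo hac hdb)⟩, hderiv⟩
  rw [contDiff_infty_iff_deriv, hderiv]
  exact ⟨fun x => (hd x).differentiableAt, hζ.1⟩

/-- The lemma of du Bois-Reymond. -/
lemma exists_ae_eq_const {a b : ℝ} (hab : a < b) {U : ℝ → ℝ} (hU : IntegrableOn U (Ioo a b))
    (h : ∀ φ, IsTest a b φ → ∫ x in Ioo a b, U x * deriv φ x = 0) :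
    ∃ d, U =ᵐ[volume.restrict (Ioo a b)] fun _ => d := by
  obtain ⟨χ, hχ, hχ1⟩ := exists_isTest_integral_eq_one hab
  refine ⟨∫ x in Ioo a b, U x * χ x, ae_eq_of_forall_isTest (IntegrableOn.locallyIntegrableOn hU)
    (locallyIntegrableOn_const _) fun η hη => ?_⟩
  -- Subtracting a multiple of `χ` gives mean zero, hence a derivative of a test function; the
  -- constant sought is the pairing of `U` with `χ`.
  have hζ : IsTest a b (fun x => η x - (∫ x in Ioo a b, η x) * χ x) := by
    refine ⟨hη.1.sub (contDiff_const.mul hχ.1), hη.2.1.sub hχ.2.1.mul_left, ?_⟩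
    refine (tsupport_sub _ _).trans (union_subset hη.2.2 ?_)
    exact (tsupport_mul_subset_right (f := fun _ => ∫ x in Ioo a b, η x) (g := χ)).trans hχ.2.2
  have hη' := hη.bddMeas.integrableOn
  have hχ' := hχ.bddMeas.integrableOn
  obtain ⟨φ, hφ, hφζ⟩ := hζ.exists_antideriv hab (by
    rw [integral_sub hη' (hχ'.const_mul _), integral_const_mul, hχ1]; ring)
  have := h φ hφ
  rw [hφζ] at this
  simp only [mul_sub, mul_left_comm (U _)] at this
  rw [integral_sub (IntegrableOn.mul_bddMeas hU hη.bddMeas)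
    ((IntegrableOn.mul_bddMeas hU hχ.bddMeas).const_mul _), integral_const_mul] at this
  rw [integral_const_mul]
  linarith

/-- The Beta integral with `y` at the starting endpoint. The kernel with pole there is thus the
analogue of a constant function: its `I^{1-α}` is constant, so its weak derivative is zero. -/
lemma fracInt_kern_startPt (s : Side) {α a b x : ℝ} (h0 : 0 < α) (h1 : α < 1)
    (hx : x ∈ Ioo a b) :
    fracInt s (1 - α) a b (fun t => kern s α t (startPt s a b)) x = Real.Gamma α := by
  have hab := hx.1.trans hx.2
  have hy : startPt s a b ∈ Icc a b := by
    cases s <;> simp [startPt, hab.le]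
  have hk : kern s 1 x (startPt s a b) = 1 := by
    cases s <;> simp [kern, startPt, hx.1, hx.2]
  have := integral_kern_mul_kern s (α := 1 - α) (by linarith) (by linarith)
    (Ioo_subset_Icc_self hx) hy
  rw [sub_sub_cancel, hk] at this
  rw [fracInt_eq _ _ hx, this]
  have h4 := (Real.Gamma_pos_of_pos (sub_pos.2 h1)).ne'
  field_simp

/-- A function with an integrable weak fractional derivative is a fractional integral up to a
multiple of the kernel at the starting point. -/
lemma IsWeakDeriv.exists_ae_eq {s : Side} {α a b : ℝ} (hab : a < b) (h0 : 0 < α) (h1 : α < 1)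
    {u w : ℝ → ℝ} (hu : IsWeakDeriv s α a b u w) (hw : IntegrableOn w (Ioo a b)) :
    ∃ c, u =ᵐ[volume.restrict (Ioo a b)]
      fun x => c * kern s α x (startPt s a b) + fracInt s α a b w x := by
  have h1' : 0 < 1 - α := by linarith
  have h1'' : 1 - α ≤ 1 := by linarith
  -- The remainder has weak derivative zero; integration by parts turns this into a vanishing
  -- ordinary derivative of `I^{1-α} r`, which is therefore a constant `d`.
  set r : ℝ → ℝ := fun x => u x + (-1) * fracInt s α a b w x with hr
  have hr0 : IsWeakDeriv s α a b r (fun x => w x + (-1) * w x) :=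
    hu.add_mul h0 h1 (isWeakDeriv_fracInt s h0 h1 hw) (-1)
  have hrU : IntegrableOn (fracInt s (1 - α) a b r) (Ioo a b) :=
    integrableOn_fracInt s h1' h1'' hr0.1
  obtain ⟨d, hd⟩ := exists_ae_eq_const hab hrU fun φ hφ => by
    have h2 := hr0.2.2 φ hφ
    rw [testDeriv_eq, integral_mul_fracInt _ h1' h1'' hr0.1 (hφ.bddMeas_sder _), Side.opp_opp] at h2
    simp only [neg_mul, one_mul, add_neg_cancel, zero_mul, integral_zero] at h2
    cases s
    · simpa [sder, Side.opp, integral_neg, eq_comm] using h2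
    · simpa [sder, Side.opp, eq_comm] using h2
  have hk : IntegrableOn (fun x => kern s α x (startPt s a b)) (Ioo a b) :=
    integrableOn_kern s h0 h1.le a b _
  have hG := (Real.Gamma_pos_of_pos h0).ne'
  refine ⟨d / Real.Gamma α, ?_⟩
  have key : r =ᵐ[volume.restrict (Ioo a b)]
      fun x => d / Real.Gamma α * kern s α x (startPt s a b) := by
    refine ae_eq_of_forall_isTest (IntegrableOn.locallyIntegrableOn hr0.1)
      (IntegrableOn.locallyIntegrableOn (hk.const_mul _)) fun ψ hψ => ?_
    -- Injectivity of `I^{1-α}` by duality: each test function `ψ` is `I^{1-α} G` of the opposite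
    -- direction, so pairings with `ψ` depend only on `I^{1-α}` of the other factor. For `r` and for
    -- the kernel these are the constants `d` and `Γ(α)`.
    set G := fracInt s.opp α a b (sder s.opp ψ)
    have hGb : BddMeas a b G := (hψ.bddMeas_sder _).fracInt _ h0 h1.le
    have e : ∀ F : ℝ → ℝ, IntegrableOn F (Ioo a b) → ∫ x in Ioo a b, F x * ψ x
        = ∫ x in Ioo a b, fracInt s (1 - α) a b F x * G x := by
      intro F hF
      rw [integral_fracInt_mul s h1' h1'' hF hGb]
      refine setIntegral_congr_fun measurableSet_Ioo fun x hx => ?_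
      rw [fracInt_fracInt' s.opp h0 h1 (hψ.bddMeas_sder _) hx, hψ.fracInt_one_sder _ hx]
    simp only [mul_assoc]
    rw [integral_const_mul, e r hr0.1, e _ hk, ← integral_const_mul]
    refine integral_congr_ae ?_
    filter_upwards [hd, ae_restrict_mem measurableSet_Ioo] with x hx hx'
    rw [hx, fracInt_kern_startPt s h0 h1 hx']
    field_simp
  filter_upwards [key] with x hx
  simp only [hr] at hx
  linarith

/-! ### Boundary layers -/

lemma measurableSet_boundaryLayer (s : Side) (a b ε : ℝ) :
    MeasurableSet (boundaryLayer s a b ε) := by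
  cases s <;> exact measurableSet_Ioo

lemma volume_boundaryLayer (s : Side) (a b ε : ℝ) :
    volume (boundaryLayer s a b ε) = ENNReal.ofReal ε := by
  cases s <;> simp [boundaryLayer]

lemma boundaryLayer_subset (s : Side) {a b ε : ℝ} (h : ε ≤ b - a) :
    boundaryLayer s a b ε ⊆ Ioo a b := by
  cases s
  · exact Ioo_subset_Ioo_left (by linarith)
  · exact Ioo_subset_Ioo_right (by linarith)

lemma abs_sub_lt_of_mem_boundaryLayer {s : Side} {a b ε x : ℝ} (h : x ∈ boundaryLayer s a b ε) :
    0 < |x - startPt s.opp a b| ∧ |x - startPt s.opp a b| < ε := by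
  cases s
  · have h1 : b - ε < x := h.1
    have h2 : x < b := h.2
    simp only [Side.opp, startPt]
    rw [abs_sub_comm, abs_of_pos (by linarith)]
    constructor <;> linarith
  · have h1 : a < x := h.1
    have h2 : x < a + ε := h.2
    simp only [Side.opp, startPt]
    rw [abs_of_pos (by linarith)]
    constructor <;> linarith

lemma eventually_small {d : ℝ} (hd : 0 < d) : ∀ᶠ ε : ℝ in 𝓝[>] 0, 0 < ε ∧ ε ≤ d := by
  filter_upwards [self_mem_nhdsWithin, Ioo_mem_nhdsGT hd] with ε h1 h2
  exact ⟨h1, h2.2.le⟩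

lemma mem_boundaryLayer_of_kern_ne_zero {s : Side} {β a b ε x y : ℝ}
    (hx : x ∈ boundaryLayer s a b ε) (hy : y ∈ Ioo a b) (h : kern s.opp β x y ≠ 0) :
    y ∈ boundaryLayer s a b ε := by
  cases s
  · have : x < y := by by_contra h1; simp [kern, Side.opp, h1] at h
    exact ⟨(hx.1 : b - ε < x).trans this, hy.2⟩
  · have : y < x := by by_contra h1; simp [kern, Side.opp, h1] at h
    exact ⟨hy.1, this.trans (hx.2 : x < a + ε)⟩

lemma mem_cut_of_kern_ne_zero {s : Side} {β a b x y : ℝ} (hy : y ∈ Ioo a b)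
    (h : kern s β x y ≠ 0) : y ∈ cut s a b x := by
  cases s
  · have : y < x := by by_contra h1; simp [kern, h1] at h
    exact ⟨hy.1, this⟩
  · have : x < y := by by_contra h1; simp [kern, h1] at h
    exact ⟨this, hy.2⟩

lemma enorm_fracInt_le (s : Side) (β : ℝ) {a b x : ℝ} (hx : x ∈ Ioo a b) (g : ℝ → ℝ) {S : Set ℝ}
    (hS : MeasurableSet S) (h : ∀ y ∈ Ioo a b, kern s β x y ≠ 0 → y ∈ S) :
    ‖fracInt s β a b g x‖ₑ ≤ ‖(Real.Gamma β)⁻¹‖ₑ * ∫⁻ y in S, riesz β x y * ‖g y‖ₑ := by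
  rw [fracInt_eq s β hx, enorm_mul]
  gcongr
  refine (enorm_integral_le_lintegral_enorm _).trans ?_
  rw [← lintegral_indicator hS]
  refine le_trans ?_ (setLIntegral_le_lintegral (Ioo a b) _)
  refine setLIntegral_mono' measurableSet_Ioo fun y hy => ?_
  by_cases hy' : y ∈ S
  · rw [indicator_of_mem hy', enorm_mul]
    gcongr
    exact enorm_kern_le ..
  · have : kern s β x y = 0 := by by_contra h1; exact hy' (h y hy h1)
    simp [this]

lemma tendsto_lintegral_boundaryLayer (s : Side) {a b : ℝ} (hab : a < b) {F : ℝ → ℝ≥0∞}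
    (hF : ∫⁻ x in Ioo a b, F x ≠ ⊤) :
    Tendsto (fun ε => ∫⁻ x in boundaryLayer s a b ε, F x) (𝓝[>] 0) (𝓝 0) := by
  have hv : Tendsto (fun ε : ℝ => ENNReal.ofReal ε) (𝓝[>] 0) (𝓝 0) := by
    have := (ENNReal.continuous_ofReal.tendsto 0).mono_left
      (nhdsWithin_le_nhds (s := Ioi (0 : ℝ)))
    simpa using this
  have h := tendsto_setLIntegral_zero (μ := volume.restrict (Ioo a b)) hF (l := 𝓝[>] (0 : ℝ))
    (s := fun ε => boundaryLayer s a b ε) (by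
      refine tendsto_of_tendsto_of_tendsto_of_le_of_le tendsto_const_nhds hv
        (fun _ => zero_le) fun ε => ?_
      exact (Measure.restrict_apply_le _ _).trans (volume_boundaryLayer s a b ε).le)
  refine h.congr' ((eventually_small (sub_pos.2 hab)).mono fun ε hε => ?_)
  rw [Measure.restrict_restrict_of_subset (boundaryLayer_subset s hε.2)]

/-- The integral of `F` over the boundary layer of width `ε` is `o(ε ^ γ)`. -/
def LayerSmall (s : Side) (γ a b : ℝ) (F : ℝ → ℝ≥0∞) : Prop :=
  Tendsto (fun ε : ℝ => ENNReal.ofReal (ε ^ (-γ)) * ∫⁻ x in boundaryLayer s a b ε, F x)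
    (𝓝[>] 0) (𝓝 0)

lemma layerSmall_of_le {s : Side} {γ a b : ℝ} {F : ℝ → ℝ≥0∞} {B : ℝ → ℝ≥0∞}
    (hB : Tendsto B (𝓝[>] 0) (𝓝 0))
    (h : ∀ᶠ ε : ℝ in 𝓝[>] 0,
      ENNReal.ofReal (ε ^ (-γ)) * ∫⁻ x in boundaryLayer s a b ε, F x ≤ B ε) :
    LayerSmall s γ a b F :=
  tendsto_of_tendsto_of_tendsto_of_le_of_le' tendsto_const_nhds hB
    (Eventually.of_forall fun _ => zero_le) h

lemma LayerSmall.mono {s : Side} {γ a b : ℝ} (hab : a < b) {F G : ℝ → ℝ≥0∞}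
    (hG : LayerSmall s γ a b G) (h : ∀ᵐ x ∂volume.restrict (Ioo a b), F x ≤ G x) :
    LayerSmall s γ a b F := by
  refine layerSmall_of_le hG ((eventually_small (sub_pos.2 hab)).mono fun ε hε => ?_)
  refine mul_le_mul_right (lintegral_mono_ae ?_) _
  exact ae_restrict_of_ae_restrict_of_subset (boundaryLayer_subset s hε.2) h

lemma LayerSmall.add {s : Side} {γ a b : ℝ} (hab : a < b) {F G : ℝ → ℝ≥0∞}
    (hF : LayerSmall s γ a b F) (hG : LayerSmall s γ a b G)
    (hm : AEMeasurable F (volume.restrict (Ioo a b))) :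
    LayerSmall s γ a b (fun x => F x + G x) := by
  have := Tendsto.add hF hG
  rw [add_zero] at this
  refine this.congr' ((eventually_small (sub_pos.2 hab)).mono fun ε hε => ?_)
  beta_reduce
  rw [lintegral_add_left' (hm.mono_measure
    (Measure.restrict_mono (boundaryLayer_subset s hε.2) le_rfl)), mul_add]

lemma tendsto_ofReal_mul_rpow {D δ : ℝ} (hδ : 0 < δ) :
    Tendsto (fun ε : ℝ => ENNReal.ofReal (D * ε ^ δ)) (𝓝[>] 0) (𝓝 0) := by
  have h : Tendsto (fun ε : ℝ => ENNReal.ofReal (D * ε ^ δ)) (𝓝 0)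
      (𝓝 (ENNReal.ofReal (D * 0 ^ δ))) := by
    refine (ENNReal.continuous_ofReal.tendsto _).comp (Tendsto.const_mul D ?_)
    exact (Real.continuousAt_rpow_const 0 δ (Or.inr hδ.le)).tendsto
  simp only [Real.zero_rpow hδ.ne', mul_zero, ENNReal.ofReal_zero] at h
  exact h.mono_left nhdsWithin_le_nhds

/-- The mass is at most `D * ε`, which is `o(ε ^ γ)` because `γ < 1`. -/
lemma layerSmall_of_bdd {s : Side} {γ a b d D : ℝ} (hγ : γ < 1) (hd : 0 < d)
    {F : ℝ → ℝ≥0∞} (h : ∀ x ∈ boundaryLayer s a b d, F x ≤ ENNReal.ofReal D) :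
    LayerSmall s γ a b F := by
  refine layerSmall_of_le (tendsto_ofReal_mul_rpow (D := D) (sub_pos.2 hγ))
    ((eventually_small hd).mono fun ε hε => ?_)
  have hsub : boundaryLayer s a b ε ⊆ boundaryLayer s a b d := by
    cases s
    · exact Ioo_subset_Ioo_left (by linarith)
    · exact Ioo_subset_Ioo_right (by linarith)
  have : ∫⁻ x in boundaryLayer s a b ε, F x ≤ ENNReal.ofReal D * ENNReal.ofReal ε := by
    rw [← volume_boundaryLayer s a b ε, ← setLIntegral_const]
    exact setLIntegral_mono' (measurableSet_boundaryLayer ..) fun x hx => h x (hsub hx)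
  refine (mul_le_mul_right this _).trans ?_
  rw [mul_left_comm, ← ENNReal.ofReal_mul (by have := hε.1; positivity),
    ← Real.rpow_add_one hε.1.ne', mul_comm D, ENNReal.ofReal_mul (by have := hε.1; positivity),
    mul_comm, neg_add_eq_sub]

/-- The pole is interior, so the kernel is bounded on a layer of half its distance to the endpoint.
This is the pointwise limit in the dominated convergence argument for fractional integrals. -/
lemma layerSmall_riesz {s : Side} {β a b y : ℝ} (hβ1 : β < 1)
    (hy : y ∈ Ioo a b) : LayerSmall s β a b (fun x => riesz β x y) := by
  have hd : 0 < |y - startPt s.opp a b| := by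
    refine abs_pos.2 (sub_ne_zero.2 ?_)
    cases s
    · exact hy.2.ne
    · exact hy.1.ne'
  refine layerSmall_of_bdd (d := |y - startPt s.opp a b| / 2)
    (D := (|y - startPt s.opp a b| / 2) ^ (β - 1)) hβ1 (by positivity) fun x hx => ?_
  refine ENNReal.ofReal_le_ofReal (Real.rpow_le_rpow_of_nonpos (by positivity) ?_ (by linarith))
  have h1 := (abs_sub_lt_of_mem_boundaryLayer hx).2
  have h2 := abs_sub_le y x (startPt s.opp a b)
  rw [abs_sub_comm y x] at h2
  linarith

/-- Fractional integrals of order `β` of integrable functions have mass `o(ε ^ β)` in boundary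
layers. -/
lemma layerSmall_fracInt (s s' : Side) {β a b : ℝ} (hab : a < b) (hβ : 0 < β) (hβ1 : β < 1)
    {h : ℝ → ℝ} (hh : IntegrableOn h (Ioo a b)) :
    LayerSmall s β a b (fun x => ‖fracInt s' β a b h x‖ₑ) := by
  -- By Tonelli the rescaled mass of the layer is an integral against `‖h y‖ₑ`. The rescaled kernel
  -- mass is at most `2 / β + 1` for all `ε` and `y` and tends to zero for each interior `y`;
  -- dominated convergence improves the order `O` to `o`.
  have hlim : Tendsto (fun ε : ℝ => ∫⁻ y in Ioo a b,
      ‖h y‖ₑ * (ENNReal.ofReal (ε ^ (-β)) * ∫⁻ x in boundaryLayer s a b ε, riesz β x y))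
      (𝓝[>] 0) (𝓝 (∫⁻ _ in Ioo a b, 0)) := by
    refine tendsto_lintegral_filter_of_dominated_convergence'
      (fun y => ‖h y‖ₑ * ENNReal.ofReal (2 / β + 1)) ?_ ?_ ?_ ?_
    · refine Eventually.of_forall fun ε => hh.aestronglyMeasurable.enorm.mul ?_
      exact ((measurable_riesz β).lintegral_prod_left'.const_mul _).aemeasurable
    · refine (eventually_small (sub_pos.2 hab)).mono fun ε hε => Eventually.of_forall fun y => ?_
      have hε0 := hε.1
      gcongr
      refine (mul_le_mul_right (lintegral_riesz_le hβ hβ1.le hε0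
        (volume_boundaryLayer ..).le y) _).trans ?_
      rw [← ENNReal.ofReal_mul (by positivity), mul_left_comm, ← Real.rpow_add hε0]
      simp
    · rw [lintegral_mul_const' _ _ (by simp)]
      exact ENNReal.mul_ne_top hh.2.ne (by simp)
    · refine (ae_restrict_mem measurableSet_Ioo).mono fun y hy => ?_
      have := ENNReal.Tendsto.const_mul (a := ‖h y‖ₑ) (layerSmall_riesz (s := s) hβ1 hy)
        (Or.inr enorm_ne_top)
      rwa [mul_zero] at this
  rw [lintegral_zero] at hlim
  have hlim' := ENNReal.Tendsto.const_mul (a := ‖(Real.Gamma β)⁻¹‖ₑ) hlim (Or.inr enorm_ne_top)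
  rw [mul_zero] at hlim'
  refine layerSmall_of_le hlim' ((eventually_small (sub_pos.2 hab)).mono fun ε hε => ?_)
  have hsub := boundaryLayer_subset s hε.2
  calc ENNReal.ofReal (ε ^ (-β)) * ∫⁻ x in boundaryLayer s a b ε, ‖fracInt s' β a b h x‖ₑ
      ≤ ENNReal.ofReal (ε ^ (-β)) * ∫⁻ x in boundaryLayer s a b ε,
        ‖(Real.Gamma β)⁻¹‖ₑ * ∫⁻ y in Ioo a b, riesz β x y * ‖h y‖ₑ := by
        refine mul_le_mul_right ?_ _
        exact setLIntegral_mono' (measurableSet_boundaryLayer ..) fun x hx =>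
          enorm_fracInt_le s' β (hsub hx) h measurableSet_Ioo fun y hy _ => hy
    _ = _ := by
        rw [lintegral_const_mul' _ _ enorm_ne_top, lintegral_lintegral_swap, mul_left_comm,
          ← lintegral_const_mul' _ _ (by simp)]
        · congr 1
          refine lintegral_congr fun y => ?_
          rw [lintegral_mul_const' _ _ enorm_ne_top]; ring
        · exact (measurable_riesz β).aemeasurable.mul hh.aestronglyMeasurable.enorm.comp_snd

/-- The layer of direction `s` is at the endpoint away from the pole, where the kernel is bounded.
-/
lemma layerSmall_kern_opposite (s : Side) {α a b : ℝ} (hab : a < b) (h1 : α < 1) (c : ℝ) :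
    LayerSmall s α a b (fun x => ‖c * kern s α x (startPt s a b)‖ₑ) := by
  refine layerSmall_of_bdd (d := (b - a) / 2) (D := |c| * ((b - a) / 2) ^ (α - 1)) h1
    (by linarith) fun x hx => ?_
  rw [Real.enorm_eq_ofReal_abs, abs_mul, abs_of_nonneg (kern_nonneg ..)]
  refine ENNReal.ofReal_le_ofReal (mul_le_mul_of_nonneg_left ((kern_le ..).trans ?_)
    (abs_nonneg _))
  refine Real.rpow_le_rpow_of_nonpos (by linarith) ?_ (by linarith)
  cases s
  · have : b - (b - a) / 2 < x := hx.1
    exact le_trans (by simp only [startPt]; linarith) (le_abs_self _)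
  · have : x < a + (b - a) / 2 := hx.2
    exact le_trans (by simp only [startPt]; linarith) (neg_le_abs _)

/-- Here the pole is the endpoint of the layer: on width `ε` the kernel is at least `ε ^ (α - 1)`,
so the mass is at least `|c| * ε ^ α`, which is not `o(ε ^ α)` unless `c = 0`. -/
lemma eq_zero_of_layerSmall_kern (s : Side) {α a b : ℝ} (hab : a < b) (h1 : α < 1) {c : ℝ}
    (h : LayerSmall s α a b (fun x => ‖c * kern s.opp α x (startPt s.opp a b)‖ₑ)) : c = 0 := by
  by_contra hc
  have hpos : 0 < ENNReal.ofReal |c| := by simpa using hc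
  obtain ⟨ε, h2, hε, hε'⟩ := ((h.eventually (gt_mem_nhds hpos)).and
    (eventually_small (sub_pos.2 hab))).exists
  refine absurd h2 (not_lt.2 ?_)
  have : ENNReal.ofReal (|c| * ε ^ (α - 1)) * ENNReal.ofReal ε ≤
      ∫⁻ x in boundaryLayer s a b ε, ‖c * kern s.opp α x (startPt s.opp a b)‖ₑ := by
    rw [← volume_boundaryLayer s a b ε, ← setLIntegral_const]
    refine setLIntegral_mono' (measurableSet_boundaryLayer ..) fun x hx => ?_
    rw [Real.enorm_eq_ofReal_abs, abs_mul, abs_of_nonneg (kern_nonneg ..)]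
    refine ENNReal.ofReal_le_ofReal (mul_le_mul_of_nonneg_left ?_ (abs_nonneg _))
    have hx1 := abs_sub_lt_of_mem_boundaryLayer hx
    have hk : kern s.opp α x (startPt s.opp a b) = |x - startPt s.opp a b| ^ (α - 1) := by
      cases s
      · exact if_pos hx.2
      · exact if_pos hx.1
    rw [hk]
    exact Real.rpow_le_rpow_of_nonpos hx1.1 hx1.2.le (by linarith)
  refine le_trans ?_ (mul_le_mul_right this _)
  rw [← ENNReal.ofReal_mul (by positivity), ← ENNReal.ofReal_mul (by positivity)]
  refine ENNReal.ofReal_le_ofReal (le_of_eq ?_)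
  rw [mul_assoc, ← Real.rpow_add_one hε.ne', mul_left_comm, ← Real.rpow_add hε]
  simp

/-- A function with integrable weak fractional derivatives on both sides is the fractional
integral of either of them. -/
lemma ae_eq_fracInt_of_isWeakDeriv {s : Side} {α a b : ℝ} (hab : a < b) (h0 : 0 < α) (h1 : α < 1)
    {u w z : ℝ → ℝ} (hu : IsWeakDeriv s α a b u w) (hu' : IsWeakDeriv s.opp α a b u z)
    (hw : IntegrableOn w (Ioo a b)) (hz : IntegrableOn z (Ioo a b)) :
    u =ᵐ[volume.restrict (Ioo a b)] fracInt s α a b w := by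
  obtain ⟨c, hc⟩ := hu.exists_ae_eq hab h0 h1 hw
  obtain ⟨d, hd⟩ := hu'.exists_ae_eq hab h0 h1 hz
  have hc0 : c = 0 := by
    -- The layer of direction `s.opp` is at the starting point of `s`. There the other kernel and
    -- both fractional integrals are `o(ε ^ α)`, hence so is `c` times the kernel of direction `s`.
    refine eq_zero_of_layerSmall_kern s.opp hab h1 (c := c) ?_
    rw [Side.opp_opp]
    have hm1 := (integrableOn_kern s.opp h0 h1.le a b (startPt s.opp a b)).const_mul d
    have hm2 := integrableOn_fracInt s.opp h0 h1.le hz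
    refine ((((layerSmall_kern_opposite s.opp hab h1 d).add hab
      (layerSmall_fracInt s.opp s.opp hab h0 h1 hz) hm1.aestronglyMeasurable.enorm).add hab
      (layerSmall_fracInt s.opp s hab h0 h1 hw) (hm1.aestronglyMeasurable.enorm.add
        hm2.aestronglyMeasurable.enorm))).mono hab ?_
    filter_upwards [hc, hd] with x hx hx'
    have : c * kern s α x (startPt s a b) = d * kern s.opp α x (startPt s.opp a b)
        + fracInt s.opp α a b z x - fracInt s α a b w x := by linarith
    rw [this]
    exact (enorm_sub_le).trans (by gcongr; exact enorm_add_le _ _)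
  filter_upwards [hc] with x hx
  rw [hx, hc0]; ring

lemma hasMeanTrace_zero_of_layerSmall {s : Side} {a b : ℝ} (hab : a < b) {F : ℝ → ℝ}
    (hF : AEStronglyMeasurable F (volume.restrict (Ioo a b)))
    (h : LayerSmall s 1 a b (fun x => ‖F x‖ₑ)) : HasMeanTrace s a b F 0 := by
  constructor
  · obtain ⟨ε, h2, hε, hε'⟩ := ((h.eventually (gt_mem_nhds zero_lt_one)).and
      (eventually_small (sub_pos.2 hab))).exists
    refine ⟨ε, hε, hF.mono_measure (Measure.restrict_mono (boundaryLayer_subset s hε') le_rfl), ?_⟩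
    -- An infinite integral times a positive factor would be `⊤`, contrary to the bound by `1`.
    by_contra hn
    rw [HasFiniteIntegral, lt_top_iff_ne_top, not_not] at hn
    rw [hn, ENNReal.mul_top (by simpa using Real.rpow_pos_of_pos hε (-1))] at h2
    exact not_top_lt h2
  · rw [tendsto_zero_iff_norm_tendsto_zero]
    have h2 := (ENNReal.tendsto_toReal (by simp)).comp h
    rw [ENNReal.toReal_zero] at h2
    have hfin := h.eventually (gt_mem_nhds zero_lt_one)
    refine squeeze_zero' (Eventually.of_forall fun _ => norm_nonneg _) ?_ h2
    filter_upwards [hfin, eventually_small (sub_pos.2 hab)] with ε h3 hε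
    rw [Function.comp, norm_mul, Real.norm_of_nonneg (inv_nonneg.2 hε.1.le), ENNReal.toReal_mul,
      ENNReal.toReal_ofReal (Real.rpow_nonneg hε.1.le _), Real.rpow_neg_one]
    refine mul_le_mul_of_nonneg_left ?_ (inv_nonneg.2 hε.1.le)
    simp_rw [← ofReal_norm]
    exact norm_integral_le_lintegral_norm _

/-! ### Boundary pairings -/

lemma lintegral_lintegral_riesz_le {β ε : ℝ} (hβ : 0 < β) (hβ1 : β ≤ 1) (hε : 0 < ε) {L L' : Set ℝ}
    (hL : volume L ≤ ENNReal.ofReal ε) {F : ℝ → ℝ≥0∞} (hF : AEMeasurable F (volume.restrict L')) :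
    ∫⁻ x in L, ∫⁻ y in L', riesz β x y * F y
      ≤ ENNReal.ofReal ((2 / β + 1) * ε ^ β) * ∫⁻ y in L', F y := by
  rw [lintegral_lintegral_swap ((measurable_riesz β).aemeasurable.mul hF.comp_snd),
    ← lintegral_const_mul'' _ hF]
  refine lintegral_mono fun y => ?_
  rw [lintegral_mul_const _ (measurable_riesz_left β y)]
  gcongr
  exact lintegral_riesz_le hβ hβ1 hε hL y

lemma mul_le_rpow_add_rpow {p q : ℝ} (hpq : p.HolderConjugate q) (x y : ℝ≥0∞) :
    x * y ≤ x ^ q + y ^ p := by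
  refine (ENNReal.young_inequality x y hpq.symm).trans (add_le_add ?_ ?_)
  · exact ENNReal.div_le_of_le_mul (le_mul_of_one_le_right zero_le
      (ENNReal.one_le_ofReal.2 hpq.symm.lt.le))
  · exact ENNReal.div_le_of_le_mul (le_mul_of_one_le_right zero_le
      (ENNReal.one_le_ofReal.2 hpq.lt.le))

/-- A bilinear estimate for products of two fractional integrals over a small set. -/
lemma lintegral_riesz_mul_riesz_le {β γ ε p q : ℝ} (hβ : 0 < β) (hβ1 : β ≤ 1) (hγ : 0 < γ)
    (hγ1 : γ ≤ 1) (hε : 0 < ε) (hpq : p.HolderConjugate q) {L : Set ℝ}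
    (hL : volume L ≤ ENNReal.ofReal ε) {W H : ℝ → ℝ≥0∞}
    (hW : AEMeasurable W (volume.restrict L)) (hH : AEMeasurable H (volume.restrict L)) :
    ∫⁻ x in L, (∫⁻ y in L, riesz β x y * W y) * ∫⁻ z in L, riesz γ x z * H z
      ≤ ENNReal.ofReal ((2 / β + 1) * ε ^ β) * ENNReal.ofReal ((2 / γ + 1) * ε ^ γ)
        * ((∫⁻ y in L, W y ^ q) + ∫⁻ z in L, H z ^ p) := by
  set A := ENNReal.ofReal ((2 / β + 1) * ε ^ β)
  set B := ENNReal.ofReal ((2 / γ + 1) * ε ^ γ)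
  have hA : ∀ x, ∫⁻ y in L, riesz β x y ≤ A := fun x => by
    simp_rw [riesz_comm β x]; exact lintegral_riesz_le hβ hβ1 hε hL x
  have hB : ∀ x, ∫⁻ y in L, riesz γ x y ≤ B := fun x => by
    simp_rw [riesz_comm γ x]; exact lintegral_riesz_le hγ hγ1 hε hL x
  have hWq : AEMeasurable (fun y => W y ^ q) (volume.restrict L) := hW.pow_const q
  have hHp : AEMeasurable (fun y => H y ^ p) (volume.restrict L) := hH.pow_const p
  -- Write the product as a double integral over `y` and `z` and apply Young's inequality to `W y *
  -- H z`. Each resulting term has one free variable, which integrates to a kernel mass of at most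
  -- `A` or `B`.
  have key : ∀ x, (∫⁻ y in L, riesz β x y * W y) * ∫⁻ z in L, riesz γ x z * H z
      ≤ (B * ∫⁻ y in L, riesz β x y * W y ^ q) + A * ∫⁻ z in L, riesz γ x z * H z ^ p := by
    intro x
    set D := ∫⁻ z in L, riesz γ x z * H z ^ p
    have hr := measurable_riesz_right β x
    have hr' := measurable_riesz_right γ x
    have hrW : AEMeasurable (fun y => riesz β x y * W y) (volume.restrict L) :=
      hr.aemeasurable.mul hW
    have hrH : AEMeasurable (fun y => riesz γ x y * H y) (volume.restrict L) :=
      hr'.aemeasurable.mul hH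
    have hrWq : AEMeasurable (fun y => riesz β x y * W y ^ q) (volume.restrict L) :=
      hr.aemeasurable.mul hWq
    calc (∫⁻ y in L, riesz β x y * W y) * ∫⁻ z in L, riesz γ x z * H z
        = ∫⁻ y in L, riesz β x y * ∫⁻ z in L, riesz γ x z * (W y * H z) := by
          rw [← lintegral_mul_const'' _ hrW]
          refine lintegral_congr fun y => ?_
          rw [mul_assoc, ← lintegral_const_mul'' _ hrH]
          congr 1
          exact lintegral_congr fun z => by ring
      _ ≤ ∫⁻ y in L, (B * (riesz β x y * W y ^ q) + riesz β x y * D) := by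
          refine lintegral_mono fun y => ?_
          calc riesz β x y * ∫⁻ z in L, riesz γ x z * (W y * H z)
              ≤ riesz β x y * ∫⁻ z in L, (riesz γ x z * W y ^ q + riesz γ x z * H z ^ p) := by
                refine mul_le_mul_right (lintegral_mono fun z => ?_) _
                rw [← mul_add]
                exact mul_le_mul_right (mul_le_rpow_add_rpow hpq _ _) _
            _ ≤ riesz β x y * (B * W y ^ q + D) := by
                rw [lintegral_add_left (hr'.mul_const _), lintegral_mul_const _ hr']
                gcongr
                exact hB x
            _ = _ := by ring
      _ = (B * ∫⁻ y in L, riesz β x y * W y ^ q) + (∫⁻ y in L, riesz β x y) * D := by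
          rw [lintegral_add_left' (hrWq.const_mul _),
            lintegral_const_mul'' _ hrWq,
            lintegral_mul_const _ hr]
      _ ≤ _ := by gcongr; exact hA x
  have hm : AEMeasurable (fun x => ∫⁻ y in L, riesz β x y * W y ^ q) (volume.restrict L) :=
    AEMeasurable.lintegral_prod_right' (f := fun z : ℝ × ℝ => riesz β z.1 z.2 * W z.2 ^ q)
      ((measurable_riesz β).aemeasurable.mul hWq.comp_snd)
  calc _ ≤ ∫⁻ x in L, ((B * ∫⁻ y in L, riesz β x y * W y ^ q)
        + A * ∫⁻ z in L, riesz γ x z * H z ^ p) := lintegral_mono key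
    _ = (B * ∫⁻ x in L, ∫⁻ y in L, riesz β x y * W y ^ q)
        + A * ∫⁻ x in L, ∫⁻ z in L, riesz γ x z * H z ^ p := by
      rw [lintegral_add_left' (hm.const_mul _), lintegral_const_mul' _ _ (by simp [B]),
        lintegral_const_mul' _ _ (by simp [A])]
    _ ≤ B * (A * ∫⁻ y in L, W y ^ q) + A * (B * ∫⁻ z in L, H z ^ p) := by
      gcongr
      · exact lintegral_lintegral_riesz_le hβ hβ1 hε hL hWq
      · exact lintegral_lintegral_riesz_le hγ hγ1 hε hL hHp
    _ = _ := by ring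

lemma lintegral_rpow_enorm_ne_top {μ : Measure ℝ} {q : ℝ} (hq : 1 < q) {w : ℝ → ℝ}
    (hw : MemLp w (ENNReal.ofReal q) μ) : ∫⁻ x, ‖w x‖ₑ ^ q ∂μ ≠ ⊤ := by
  have h0 : ENNReal.ofReal q ≠ 0 := by simp; linarith
  have := (eLpNorm_lt_top_iff_lintegral_rpow_enorm_lt_top h0 ENNReal.ofReal_ne_top).1 hw.2
  rw [ENNReal.toReal_ofReal (by linarith)] at this
  exact this.ne

/-- Integration in direction `s` starts at the endpoint of the layer of direction `s.opp`, so only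
values of `g` inside the layer enter. Because of this locality the bounds below contain norms over
the layer, which tend to zero. -/
lemma enorm_fracInt_le_layer (s : Side) (β : ℝ) {a b ε x : ℝ} (hε : ε ≤ b - a)
    (hx : x ∈ boundaryLayer s.opp a b ε) (g : ℝ → ℝ) :
    ‖fracInt s β a b g x‖ₑ
      ≤ ‖(Real.Gamma β)⁻¹‖ₑ * ∫⁻ y in boundaryLayer s.opp a b ε, riesz β x y * ‖g y‖ₑ := by
  refine enorm_fracInt_le s β (boundaryLayer_subset _ hε hx) g (measurableSet_boundaryLayer ..)
    fun y hy h => mem_boundaryLayer_of_kern_ne_zero (β := β) hx hy ?_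
  rwa [Side.opp_opp]

lemma MemLp.integrableOn_Ioo {a b q : ℝ} (hq : 1 < q) {w : ℝ → ℝ}
    (hw : MemLp w (ENNReal.ofReal q) (volume.restrict (Ioo a b))) : IntegrableOn w (Ioo a b) :=
  hw.integrable (ENNReal.one_le_ofReal.2 hq.le)

lemma aemeasurable_layer {s : Side} {a b ε : ℝ} (hε : ε ≤ b - a) {F : ℝ → ℝ}
    (hF : AEStronglyMeasurable F (volume.restrict (Ioo a b))) :
    AEMeasurable (fun x => ‖F x‖ₑ) (volume.restrict (boundaryLayer s a b ε)) :=
  (hF.mono_measure (Measure.restrict_mono (boundaryLayer_subset s hε) le_rfl)).enorm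

/-- Products of fractional integrals of complementary orders of functions in dual Lebesgue spaces
have vanishing mean values over boundary layers. -/
lemma layerSmall_fracInt_mul_fracInt (s : Side) {α a b p q : ℝ} (hab : a < b) (h0 : 0 < α)
    (h1 : α < 1) (hpq : p.HolderConjugate q) {w k : ℝ → ℝ}
    (hw : MemLp w (ENNReal.ofReal q) (volume.restrict (Ioo a b)))
    (hk : MemLp k (ENNReal.ofReal p) (volume.restrict (Ioo a b))) :
    LayerSmall s.opp 1 a b
      (fun x => ‖fracInt s (1 - α) a b w x * fracInt s α a b k x‖ₑ) := by
  have h1' : 0 < 1 - α := by linarith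
  set c := ‖(Real.Gamma (1 - α))⁻¹‖ₑ * ‖(Real.Gamma α)⁻¹‖ₑ
  have hc : c ≠ ⊤ := ENNReal.mul_ne_top enorm_ne_top enorm_ne_top
  set K := ENNReal.ofReal ((2 / (1 - α) + 1) * (2 / α + 1))
  have hlim := ENNReal.Tendsto.const_mul (a := c * K)
    ((tendsto_lintegral_boundaryLayer s.opp hab (lintegral_rpow_enorm_ne_top hpq.symm.lt hw)).add
      (tendsto_lintegral_boundaryLayer s.opp hab (lintegral_rpow_enorm_ne_top hpq.lt hk)))
    (Or.inr (ENNReal.mul_ne_top hc (by simp [K])))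
  rw [add_zero, mul_zero] at hlim
  refine layerSmall_of_le hlim ((eventually_small (sub_pos.2 hab)).mono fun ε hε => ?_)
  have hε0 := hε.1
  have hwm := aemeasurable_layer (s := s.opp) hε.2 hw.1
  have hkm := aemeasurable_layer (s := s.opp) hε.2 hk.1
  calc _ ≤ ENNReal.ofReal (ε ^ (-1 : ℝ)) * ∫⁻ x in boundaryLayer s.opp a b ε,
        c * ((∫⁻ y in boundaryLayer s.opp a b ε, riesz (1 - α) x y * ‖w y‖ₑ)
          * ∫⁻ z in boundaryLayer s.opp a b ε, riesz α x z * ‖k z‖ₑ) := by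
        refine mul_le_mul_right
          (setLIntegral_mono' (measurableSet_boundaryLayer ..) fun x hx => ?_) _
        rw [enorm_mul]
        refine (mul_le_mul' (enorm_fracInt_le_layer s (1 - α) hε.2 hx w)
          (enorm_fracInt_le_layer s α hε.2 hx k)).trans (le_of_eq ?_)
        simp only [c]; ring
    _ ≤ ENNReal.ofReal (ε ^ (-1 : ℝ)) * (c * (ENNReal.ofReal ((2 / (1 - α) + 1) * ε ^ (1 - α))
        * ENNReal.ofReal ((2 / α + 1) * ε ^ α) * ((∫⁻ x in boundaryLayer s.opp a b ε, ‖w x‖ₑ ^ q)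
          + ∫⁻ x in boundaryLayer s.opp a b ε, ‖k x‖ₑ ^ p))) := by
        rw [lintegral_const_mul' _ _ hc]
        refine mul_le_mul_right (mul_le_mul_right (lintegral_riesz_mul_riesz_le h1' (by linarith)
          h0 h1.le hε0 hpq (volume_boundaryLayer ..).le hwm hkm) _) _
    _ = _ := by
        -- The complementary orders cancel the factor `1 / ε` exactly, so all smallness comes from
        -- the integrals over the layer.
        have : ENNReal.ofReal (ε ^ (-1 : ℝ)) * (ENNReal.ofReal ((2 / (1 - α) + 1) * ε ^ (1 - α))
            * ENNReal.ofReal ((2 / α + 1) * ε ^ α)) = K := by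
          rw [← ENNReal.ofReal_mul (by positivity), ← ENNReal.ofReal_mul (by positivity)]
          congr 1
          have : ε ^ (-1 : ℝ) * (ε ^ (1 - α) * ε ^ α) = 1 := by
            rw [← Real.rpow_add hε0, ← Real.rpow_add hε0]; simp
          linear_combination ((2 / (1 - α) + 1) * (2 / α + 1)) * this
        rw [← this]; ring

lemma lintegral_le_mul_rpow {p q ε : ℝ} (hpq : p.HolderConjugate q) {L : Set ℝ}
    (hL : volume L ≤ ENNReal.ofReal ε) {F : ℝ → ℝ≥0∞} (hF : AEMeasurable F (volume.restrict L)) :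
    ∫⁻ x in L, F x ≤ ENNReal.ofReal ε ^ (1 / p) * (∫⁻ x in L, F x ^ q) ^ (1 / q) := by
  have := ENNReal.lintegral_mul_le_Lp_mul_Lq (volume.restrict L) hpq
    (aemeasurable_const (b := (1 : ℝ≥0∞))) hF
  simp only [Pi.mul_apply, one_mul, ENNReal.one_rpow, lintegral_const, Measure.restrict_apply
    MeasurableSet.univ, univ_inter] at this
  refine this.trans ?_
  have hp : 0 ≤ 1 / p := by have := hpq.pos; positivity
  gcongr

lemma tendsto_rpow_layer (s : Side) {a b q : ℝ} (hab : a < b) (hq : 1 < q) {w : ℝ → ℝ}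
    (hw : MemLp w (ENNReal.ofReal q) (volume.restrict (Ioo a b))) :
    Tendsto (fun ε => (∫⁻ x in boundaryLayer s a b ε, ‖w x‖ₑ ^ q) ^ (1 / q)) (𝓝[>] 0) (𝓝 0) := by
  have h := tendsto_lintegral_boundaryLayer s hab (lintegral_rpow_enorm_ne_top hq hw)
  have := (ENNReal.continuous_rpow_const (y := 1 / q)).tendsto 0 |>.comp h
  rwa [ENNReal.zero_rpow_of_pos (by positivity)] at this

/-- Kernel mass and Hölder's inequality bound the mean by `ε ^ (1 / p - α)` times the `L^q` norm
over the layer. The exponent is nonnegative for `α * p ≤ 1`, and the vanishing norm covers the case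
of equality. -/
lemma layerSmall_fracInt_of_mul_le_one (s : Side) {α a b p q : ℝ} (hab : a < b)
    (h1 : α < 1) (h0 : 0 < α) (hpq : p.HolderConjugate q) (hαp : α * p ≤ 1) {w : ℝ → ℝ}
    (hw : MemLp w (ENNReal.ofReal q) (volume.restrict (Ioo a b))) :
    LayerSmall s.opp 1 a b (fun x => ‖fracInt s (1 - α) a b w x‖ₑ) := by
  have h1' : 0 < 1 - α := by linarith
  have hp := hpq.pos
  set c := ‖(Real.Gamma (1 - α))⁻¹‖ₑ
  set K := ENNReal.ofReal (2 / (1 - α) + 1)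
  have hlim := ENNReal.Tendsto.const_mul (a := c * K)
    (tendsto_rpow_layer s.opp hab hpq.symm.lt hw)
    (Or.inr (ENNReal.mul_ne_top enorm_ne_top (by simp [K])))
  rw [mul_zero] at hlim
  refine layerSmall_of_le hlim (((eventually_small (sub_pos.2 hab)).and
    (eventually_small one_pos)).mono fun ε hε => ?_)
  obtain ⟨⟨hε0, hε1⟩, -, hε2⟩ := hε
  have hwm := aemeasurable_layer (s := s.opp) hε1 hw.1
  have hL := (volume_boundaryLayer s.opp a b ε).le
  have hr : ENNReal.ofReal (ε ^ (-1 : ℝ)) * (ENNReal.ofReal ((2 / (1 - α) + 1) * ε ^ (1 - α))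
      * ENNReal.ofReal ε ^ (1 / p)) ≤ K := by
    rw [ENNReal.ofReal_rpow_of_pos hε0, ← ENNReal.ofReal_mul (by positivity),
      ← ENNReal.ofReal_mul (by positivity)]
    refine ENNReal.ofReal_le_ofReal ?_
    have h3 : ε ^ (-1 : ℝ) * (ε ^ (1 - α) * ε ^ (1 / p)) ≤ 1 := by
      rw [← Real.rpow_add hε0, ← Real.rpow_add hε0]
      refine Real.rpow_le_one hε0.le hε2 ?_
      have : α ≤ 1 / p := by rwa [le_div_iff₀ hp]
      linarith
    have h4 : 0 ≤ 2 / (1 - α) + 1 := by positivity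
    calc _ = (2 / (1 - α) + 1) * (ε ^ (-1 : ℝ) * (ε ^ (1 - α) * ε ^ (1 / p))) := by ring
      _ ≤ _ := mul_le_of_le_one_right h4 h3
  calc _ ≤ ENNReal.ofReal (ε ^ (-1 : ℝ)) * ∫⁻ x in boundaryLayer s.opp a b ε,
        c * ∫⁻ y in boundaryLayer s.opp a b ε, riesz (1 - α) x y * ‖w y‖ₑ :=
        mul_le_mul_right (setLIntegral_mono' (measurableSet_boundaryLayer ..) fun x hx =>
          enorm_fracInt_le_layer s (1 - α) hε1 hx w) _
    _ ≤ ENNReal.ofReal (ε ^ (-1 : ℝ)) * (c * (ENNReal.ofReal ((2 / (1 - α) + 1) * ε ^ (1 - α))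
        * (ENNReal.ofReal ε ^ (1 / p)
          * (∫⁻ x in boundaryLayer s.opp a b ε, ‖w x‖ₑ ^ q) ^ (1 / q)))) := by
        rw [lintegral_const_mul' _ _ enorm_ne_top]
        refine mul_le_mul_right (mul_le_mul_right
          ((lintegral_lintegral_riesz_le h1' (by linarith) hε0 hL hwm).trans
            (mul_le_mul_right (lintegral_le_mul_rpow hpq hL hwm) _)) _) _
    _ = (ENNReal.ofReal (ε ^ (-1 : ℝ)) * (ENNReal.ofReal ((2 / (1 - α) + 1) * ε ^ (1 - α))
      * ENNReal.ofReal ε ^ (1 / p))) * (c *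
          (∫⁻ x in boundaryLayer s.opp a b ε, ‖w x‖ₑ ^ q) ^ (1 / q)) := by ring
    _ ≤ K * (c * (∫⁻ x in boundaryLayer s.opp a b ε, ‖w x‖ₑ ^ q) ^ (1 / q)) :=
        mul_le_mul_left hr _
    _ = _ := by ring

/-- On the layer `I^1 g` is bounded by the `L^1` norm of `g` there. Hölder's inequality for `g` and
for `v` yields `ε ^ (1 / p)` and `ε ^ (1 / q)`, which together cancel `1 / ε`. -/
lemma layerSmall_fracInt_one_mul (s : Side) {a b p q : ℝ} (hab : a < b)
    (hpq : p.HolderConjugate q) {g v : ℝ → ℝ}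
    (hg : MemLp g (ENNReal.ofReal q) (volume.restrict (Ioo a b)))
    (hv : MemLp v (ENNReal.ofReal p) (volume.restrict (Ioo a b))) :
    LayerSmall s.opp 1 a b (fun x => ‖fracInt s 1 a b g x * v x‖ₑ) := by
  have hlim := ENNReal.Tendsto.mul (tendsto_rpow_layer s.opp hab hpq.symm.lt hg)
    (Or.inr ENNReal.zero_ne_top) (tendsto_rpow_layer s.opp hab hpq.lt hv)
    (Or.inr ENNReal.zero_ne_top)
  rw [mul_zero] at hlim
  refine layerSmall_of_le hlim ((eventually_small (sub_pos.2 hab)).mono fun ε hε => ?_)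
  obtain ⟨hε0, hε1⟩ := hε
  have hgm := aemeasurable_layer (s := s.opp) hε1 hg.1
  have hvm := aemeasurable_layer (s := s.opp) hε1 hv.1
  have hL := (volume_boundaryLayer s.opp a b ε).le
  have hr : ENNReal.ofReal (ε ^ (-1 : ℝ))
      * (ENNReal.ofReal ε ^ (1 / p) * ENNReal.ofReal ε ^ (1 / q)) = 1 := by
    rw [ENNReal.ofReal_rpow_of_pos hε0, ENNReal.ofReal_rpow_of_pos hε0,
      ← ENNReal.ofReal_mul (by positivity), ← ENNReal.ofReal_mul (by positivity),
      ← Real.rpow_add hε0, ← Real.rpow_add hε0, one_div, one_div, hpq.inv_add_inv_eq_one]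
    simp
  calc _ ≤ ENNReal.ofReal (ε ^ (-1 : ℝ)) * ∫⁻ x in boundaryLayer s.opp a b ε,
        (∫⁻ y in boundaryLayer s.opp a b ε, ‖g y‖ₑ) * ‖v x‖ₑ := by
        refine mul_le_mul_right
          (setLIntegral_mono' (measurableSet_boundaryLayer ..) fun x hx => ?_) _
        rw [enorm_mul]
        refine mul_le_mul_left ((enorm_fracInt_le_layer s 1 hε1 hx g).trans (le_of_eq ?_)) _
        simp [riesz]
    _ ≤ ENNReal.ofReal (ε ^ (-1 : ℝ)) * ((ENNReal.ofReal ε ^ (1 / p)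
          * (∫⁻ x in boundaryLayer s.opp a b ε, ‖g x‖ₑ ^ q) ^ (1 / q))
          * (ENNReal.ofReal ε ^ (1 / q)
          * (∫⁻ x in boundaryLayer s.opp a b ε, ‖v x‖ₑ ^ p) ^ (1 / p))) := by
        rw [lintegral_const_mul'' _ hvm]
        exact mul_le_mul_right (mul_le_mul' (lintegral_le_mul_rpow hpq hL hgm)
          (lintegral_le_mul_rpow hpq.symm hL hvm)) _
    _ = (ENNReal.ofReal (ε ^ (-1 : ℝ))
      * (ENNReal.ofReal ε ^ (1 / p) * ENNReal.ofReal ε ^ (1 / q)))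
      * ((∫⁻ x in boundaryLayer s.opp a b ε, ‖g x‖ₑ ^ q) ^ (1 / q)
        * (∫⁻ x in boundaryLayer s.opp a b ε, ‖v x‖ₑ ^ p) ^ (1 / p)) := by ring
    _ = _ := by rw [hr, one_mul]

/-- Fractional integrals of order above the reciprocal exponent vanish at the starting point. -/
lemma tendsto_fracInt_of_mul_lt_one (s : Side) {α a b p q : ℝ} (hab : a < b) (h0 : 0 < α)
    (hpq : p.HolderConjugate q) (hαp : α * p < 1) {w : ℝ → ℝ}
    (hw : MemLp w (ENNReal.ofReal q) (volume.restrict (Ioo a b))) :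
    Tendsto (fracInt s (1 - α) a b w) (startFilter s a b) (𝓝 0) := by
  have hp := hpq.pos
  set e := startPt s a b
  have hle : startFilter s a b ≤ 𝓝 e := (startFilter_le_nhdsWithin hab).trans nhdsWithin_le_nhds
  have hne : ∀ x ∈ Ioo a b, 0 < |x - e| := fun x hx => by
    refine abs_pos.2 (sub_ne_zero.2 ?_)
    cases s
    · exact hx.1.ne'
    · exact hx.2.ne
  have hvol : ∀ x ∈ Ioo a b, volume (cut s a b x) ≤ ENNReal.ofReal |x - e| := fun x hx => by
    cases s
    · simp only [cut, Real.volume_Ioo]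
      exact ENNReal.ofReal_le_ofReal (le_abs_self _)
    · simp only [cut, Real.volume_Ioo]
      rw [abs_sub_comm]
      exact ENNReal.ofReal_le_ofReal (le_abs_self _)
  have hβ : 0 < 1 - α * p := by linarith
  have hT1 : Tendsto (fun x : ℝ => ENNReal.ofReal ((2 / (1 - α * p) + 1) * |x - e| ^ (1 - α * p)))
      (startFilter s a b) (𝓝 0) := by
    refine (tendsto_ofReal_mul_rpow hβ).comp (tendsto_nhdsWithin_iff.2 ⟨?_, ?_⟩)
    · refine Tendsto.mono_left ?_ hle
      have : Tendsto (fun x : ℝ => |x - e|) (𝓝 e) (𝓝 |e - e|) :=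
        (by fun_prop : Continuous fun x : ℝ => |x - e|).tendsto e
      simpa using this
    · exact (eventually_startFilter_mem hab).mono hne
  have hT2 : Tendsto (fun x => ∫⁻ y in cut s a b x, ‖w y‖ₑ ^ q ∂(volume.restrict (Ioo a b)))
      (startFilter s a b) (𝓝 0) := by
    refine tendsto_setLIntegral_zero (lintegral_rpow_enorm_ne_top hpq.symm.lt hw) ?_
    exact tendsto_of_tendsto_of_tendsto_of_le_of_le tendsto_const_nhds
      ((tendsto_volume_cut s a b).mono_left hle) (fun _ => zero_le)
      fun x => Measure.restrict_apply_le _ _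
  have hT := ENNReal.Tendsto.const_mul (a := ‖(Real.Gamma (1 - α))⁻¹‖ₑ) (hT2.add hT1)
    (Or.inr enorm_ne_top)
  rw [add_zero, mul_zero] at hT
  rw [tendsto_zero_iff_enorm_tendsto_zero]
  refine tendsto_of_tendsto_of_tendsto_of_le_of_le' tendsto_const_nhds hT
    (Eventually.of_forall fun _ => zero_le) ((eventually_startFilter_mem hab).mono fun x hx => ?_)
  refine (enorm_fracInt_le s (1 - α) hx w (measurableSet_cut s a b x)
    fun y hy h => mem_cut_of_kern_ne_zero hy h).trans (mul_le_mul_right ?_ _)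
  rw [Measure.restrict_restrict_of_subset (cut_subset hx)]
  calc ∫⁻ y in cut s a b x, riesz (1 - α) x y * ‖w y‖ₑ
      ≤ ∫⁻ y in cut s a b x, (‖w y‖ₑ ^ q + riesz (1 - α * p) y x) := by
        refine lintegral_mono fun y => ?_
        rw [mul_comm]
        refine (mul_le_rpow_add_rpow hpq _ _).trans (le_of_eq ?_)
        congr 1
        -- The `p`-th power of the kernel of order `1 - α` has exponent `-α * p`, so it is the
        -- kernel of order `1 - α * p`, positive by assumption.
        rw [riesz, riesz, ENNReal.ofReal_rpow_of_nonneg (by positivity) hp.le,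
          ← Real.rpow_mul (abs_nonneg _), abs_sub_comm]
        congr 2; ring
    _ = (∫⁻ y in cut s a b x, ‖w y‖ₑ ^ q) + ∫⁻ y in cut s a b x, riesz (1 - α * p) y x := by
        rw [lintegral_add_right _ (measurable_riesz_left _ x)]
    _ ≤ _ := by
        gcongr
        exact lintegral_riesz_le hβ (by nlinarith) (hne x hx) (hvol x hx) x

/-! ### The energy space -/

lemma ae_integrable_kern_mul (s : Side) {β a b : ℝ} (hβ : 0 < β) (hβ1 : β ≤ 1) {g : ℝ → ℝ}
    (hg : IntegrableOn g (Ioo a b)) :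
    ∀ᵐ x ∂volume.restrict (Ioo a b), IntegrableOn (fun y => kern s β x y * g y) (Ioo a b) := by
  have h1 : BddMeas a b (fun _ => 1) := ⟨aestronglyMeasurable_const, 1, by simp⟩
  have h := (integrable_kern_prod s.opp hβ hβ1 hg h1).prod_left_ae
  simpa [kern_opp, mul_comm, IntegrableOn] using h

/-- Linearity holds only where both kernel integrals converge, which for integrable functions is
almost everywhere. -/
lemma fracInt_add_mul_ae (s : Side) {β a b : ℝ} (hβ : 0 < β) (hβ1 : β ≤ 1) {g h : ℝ → ℝ}
    (hg : IntegrableOn g (Ioo a b)) (hh : IntegrableOn h (Ioo a b)) (t : ℝ) :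
    ∀ᵐ x ∂volume.restrict (Ioo a b), fracInt s β a b (fun y => g y + t * h y) x
      = fracInt s β a b g x + t * fracInt s β a b h x := by
  filter_upwards [ae_integrable_kern_mul s hβ hβ1 hg, ae_integrable_kern_mul s hβ hβ1 hh,
    ae_restrict_mem measurableSet_Ioo] with x h1 h2 hx
  rw [fracInt_eq s β hx, fracInt_eq s β hx, fracInt_eq s β hx]
  simp_rw [mul_add, mul_left_comm _ t]
  rw [integral_add h1 (h2.const_mul t), integral_const_mul]
  ring

/-- This is what the factor `ae volume` in `startFilter` is for: almost everywhere identities pass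
to endpoint limits. -/
lemma eventually_startFilter_of_ae {s : Side} {a b : ℝ} (hab : a < b) {P : ℝ → Prop}
    (h : ∀ᵐ x ∂volume.restrict (Ioo a b), P x) : ∀ᶠ x in startFilter s a b, P x := by
  rw [ae_restrict_iff' measurableSet_Ioo] at h
  have hle : startFilter s a b ≤ ae volume := by cases s <;> exact inf_le_right
  filter_upwards [hle h, eventually_startFilter_mem hab] with x h1 h2 using h1 h2

lemma oneSidedSobolev_add_mul {s : Side} {α p a b : ℝ} (h0 : 0 < α) (h1 : α < 1)
    {u v : ℝ → ℝ} (hu : u ∈ oneSidedSobolev s α p a b) (hv : v ∈ oneSidedSobolev s α p a b)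
    (t : ℝ) : (fun x => u x + t * v x) ∈ oneSidedSobolev s α p a b := by
  obtain ⟨hu1, w, hw, hwp⟩ := hu
  obtain ⟨hv1, z, hz, hzp⟩ := hv
  exact ⟨hu1.add (hv1.const_mul t), _, hw.add_mul h0 h1 hz t, hwp.add (hzp.const_mul t)⟩

lemma ringSobolev_add_mul {s : Side} {α p a b : ℝ} (hab : a < b) (h0 : 0 < α) (h1 : α < 1)
    {u v : ℝ → ℝ} (hu : u ∈ ringSobolev s α p a b) (hv : v ∈ ringSobolev s α p a b)
    (t : ℝ) : (fun x => u x + t * v x) ∈ ringSobolev s α p a b := by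
  refine ⟨oneSidedSobolev_add_mul h0 h1 hu.1 hv.1 t, ?_⟩
  obtain ⟨-, w, hw, -⟩ := hu.1
  obtain ⟨-, z, hz, -⟩ := hv.1
  have := hu.2.add (hv.2.const_mul t)
  rw [mul_zero, add_zero] at this
  exact this.congr' ((eventually_startFilter_of_ae hab
    (fracInt_add_mul_ae s (by linarith) (by linarith) hw.1 hz.1 t)).mono fun x hx => hx.symm)

lemma memLp_weakDeriv {s : Side} {α p a b : ℝ} {u : ℝ → ℝ} (hu : u ∈ oneSidedSobolev s α p a b) :
    MemLp (weakDeriv s α a b u) (ENNReal.ofReal p) (volume.restrict (Ioo a b)) := by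
  obtain ⟨-, w, hw, hp⟩ := hu
  exact hp.ae_eq hw.weakDeriv_ae_eq.symm

lemma isWeakDeriv_weakDeriv {s : Side} {α p a b : ℝ} {u : ℝ → ℝ}
    (hu : u ∈ oneSidedSobolev s α p a b) : IsWeakDeriv s α a b u (weakDeriv s α a b u) := by
  obtain ⟨-, w, hw, hp⟩ := hu
  exact hw.isWeakDeriv_weakDeriv

section EnergySpace

variable {α p θ lam a b : ℝ} {u v : ℝ → ℝ}

/-- The alternative that the coefficient vanishes lets all values of `θ` be treated at once: with
coefficient `0` the term is zero whatever `weakDeriv` is. -/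
lemma energySpace_left (hv : v ∈ energySpace α p θ lam a b) :
    1 - θ = 0 ∨ v ∈ oneSidedSobolev .left α p a b := by
  unfold energySpace at hv
  split_ifs at hv with h1 h2 h3 h4
  · exact Or.inr hv.1
  · exact Or.inr hv
  · exact Or.inl (by linarith)
  · exact Or.inl (by linarith)
  · exact Or.inr hv.1

lemma energySpace_right (hv : v ∈ energySpace α p θ lam a b) :
    θ = 0 ∨ v ∈ oneSidedSobolev .right α p a b := by
  unfold energySpace at hv
  split_ifs at hv with h1 h2 h3 h4
  · exact Or.inl h1
  · exact Or.inl h1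
  · exact Or.inr hv.1
  · exact Or.inr hv
  · exact Or.inr hv.2

lemma memLp_of_mem_energySpace (hv : v ∈ energySpace α p θ lam a b) :
    MemLp v (ENNReal.ofReal p) (volume.restrict (Ioo a b)) := by
  rcases energySpace_left hv with h | h
  · rcases energySpace_right hv with h' | h'
    · linarith
    · exact h'.1
  · exact h.1

lemma energySpace_add_mul (hab : a < b) (h0 : 0 < α) (h1 : α < 1)
    (hu : u ∈ energySpace α p θ lam a b) (hv : v ∈ energySpace α p θ lam a b) (t : ℝ) :
    (fun x => u x + t * v x) ∈ energySpace α p θ lam a b := by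
  unfold energySpace at *
  split_ifs at * with h1 h2 h3 h4
  · exact ringSobolev_add_mul hab h0 ‹_› hu hv t
  · exact oneSidedSobolev_add_mul h0 ‹_› hu hv t
  · exact ringSobolev_add_mul hab h0 ‹_› hu hv t
  · exact oneSidedSobolev_add_mul h0 ‹_› hu hv t
  · exact ⟨oneSidedSobolev_add_mul h0 ‹_› hu.1 hv.1 t, oneSidedSobolev_add_mul h0 ‹_› hu.2 hv.2 t⟩

lemma ringSobolev_left_subset_energySpace :
    ringSobolev .left α p a b ⊆ energySpace α p 0 lam a b := by
  intro v hv
  unfold energySpace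
  rw [if_pos rfl]
  split_ifs
  · exact hv
  · exact hv.1

lemma ringSobolev_right_subset_energySpace :
    ringSobolev .right α p a b ⊆ energySpace α p 1 lam a b := by
  intro v hv
  unfold energySpace
  rw [if_neg one_ne_zero, if_pos rfl]
  split_ifs
  · exact hv
  · exact hv.1

lemma IsTest.mem_energySpace (hab : a < b) (h0 : 0 < α) (h1 : α < 1) {φ : ℝ → ℝ}
    (hφ : IsTest a b φ) : φ ∈ energySpace α p θ lam a b := by
  have := fun s => hφ.mem_ringSobolev hab s h0 h1 p
  unfold energySpace
  split_ifs
  · exact this _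
  · exact (this _).1
  · exact this _
  · exact (this _).1
  · exact ⟨(this _).1, (this _).1⟩

end EnergySpace

/-! ### First variation -/

lemma abs_rpow_sub_two_mul_self {p : ℝ} (hp : 1 < p) (x : ℝ) :
    |(|x| ^ (p - 2) * x)| = |x| ^ (p - 1) := by
  rw [abs_mul, abs_of_nonneg (by positivity)]
  rcases eq_or_ne x 0 with rfl | hx
  · rw [abs_zero, mul_zero, Real.zero_rpow (by linarith)]
  · rw [← Real.rpow_add_one (abs_ne_zero.2 hx)]
    congr 1; ring

/-- The absolute value is `|D| ^ (p - 1)`, and `p / (p - 1) = q`. -/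
lemma memLp_abs_rpow_sub_two_mul_self {μ : Measure ℝ} {p q : ℝ} (hpq : p.HolderConjugate q)
    {D : ℝ → ℝ} (hD : MemLp D (ENNReal.ofReal p) μ) :
    MemLp (fun x => |D x| ^ (p - 2) * D x) (ENNReal.ofReal q) μ := by
  have hp := hpq.lt
  have h := hD.norm_rpow_div (ENNReal.ofReal (p - 1))
  have e : ENNReal.ofReal p / ENNReal.ofReal (p - 1) = ENNReal.ofReal q := by
    rw [← ENNReal.ofReal_div_of_pos (by linarith), hpq.conjugate_eq]
  rw [e, ENNReal.toReal_ofReal (by linarith)] at h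
  refine h.of_le ?_ (Eventually.of_forall fun x => ?_)
  · exact ((hD.1.aemeasurable.abs.pow_const _).mul hD.1.aemeasurable).aestronglyMeasurable
  · rw [Real.norm_eq_abs, abs_rpow_sub_two_mul_self hp, Real.norm_eq_abs]
    exact le_abs_self _

lemma integrable_abs_rpow {μ : Measure ℝ} {p : ℝ} (hp : 1 < p) {A : ℝ → ℝ}
    (hA : MemLp A (ENNReal.ofReal p) μ) : Integrable (fun x => |A x| ^ p) μ := by
  have := hA.integrable_norm_rpow (by simp; linarith) ENNReal.ofReal_ne_top
  rwa [ENNReal.toReal_ofReal (by linarith)] at this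

lemma integrable_mul_of_memLp {μ : Measure ℝ} {p q : ℝ} (hpq : p.HolderConjugate q) {f v : ℝ → ℝ}
    (hf : MemLp f (ENNReal.ofReal q) μ) (hv : MemLp v (ENNReal.ofReal p) μ) :
    Integrable (fun x => f x * v x) μ := by
  have : (ENNReal.ofReal q).HolderConjugate (ENNReal.ofReal p) :=
    hpq.symm.ennrealOfReal
  exact hf.integrable_mul hv

lemma hasDerivAt_integral_abs_rpow {μ : Measure ℝ} {p : ℝ} (hp : 1 < p) {A B : ℝ → ℝ}
    (hA : MemLp A (ENNReal.ofReal p) μ) (hB : MemLp B (ENNReal.ofReal p) μ) :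
    HasDerivAt (fun t : ℝ => ∫ x, 1 / p * |A x + t * B x| ^ p ∂μ)
      (∫ x, |A x| ^ (p - 2) * A x * B x ∂μ) 0 := by
  have hAm := hA.1.aemeasurable
  have hBm := hB.1.aemeasurable
  -- For `|t| < 1` the derivative is at most `(|A| + |B|) ^ (p - 1) * |B|`, hence at most the
  -- integrable `(|A| + |B|) ^ p`.
  have h := hasDerivAt_integral_of_dominated_loc_of_deriv_le (μ := μ) (x₀ := (0 : ℝ))
    (s := Metric.ball 0 1) (F := fun t x => 1 / p * |A x + t * B x| ^ p)
    (F' := fun t x => |A x + t * B x| ^ (p - 2) * (A x + t * B x) * B x)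
    (bound := fun x => |(|A x| + |B x|)| ^ p) (Metric.ball_mem_nhds _ one_pos) ?_ ?_ ?_ ?_ ?_ ?_
  · simpa using h.2
  · refine Eventually.of_forall fun t => ?_
    exact (((hAm.add (hBm.const_mul t)).abs.pow_const p).const_mul _).aestronglyMeasurable
  · simpa using (integrable_abs_rpow hp hA).const_mul (1 / p)
  · simp only [zero_mul, add_zero]
    exact (((hAm.abs.pow_const _).mul hAm).mul hBm).aestronglyMeasurable
  · refine Eventually.of_forall fun x t ht => ?_
    have ht' : |t| ≤ 1 := by simpa using (mem_ball_zero_iff.1 ht).le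
    rw [Real.norm_eq_abs, abs_mul, abs_rpow_sub_two_mul_self hp]
    have h1 : |A x + t * B x| ≤ |A x| + |B x| := by
      refine (abs_add_le _ _).trans ?_
      rw [abs_mul]
      have := mul_le_of_le_one_left (abs_nonneg (B x)) ht'
      linarith
    have h2 : (0 : ℝ) ≤ |A x| + |B x| := by positivity
    calc |A x + t * B x| ^ (p - 1) * |B x|
        ≤ (|A x| + |B x|) ^ (p - 1) * (|A x| + |B x|) := by
          gcongr
          linarith [abs_nonneg (A x)]
      _ = |(|A x| + |B x|)| ^ p := by
          rw [abs_of_nonneg h2]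
          rcases h2.eq_or_lt with h3 | h3
          · rw [← h3, mul_zero, Real.zero_rpow (by linarith)]
          · rw [← Real.rpow_add_one h3.ne', sub_add_cancel]
  · have : MemLp (fun x => |A x| + |B x|) (ENNReal.ofReal p) μ := hA.norm.add hB.norm
    exact integrable_abs_rpow hp this
  · refine Eventually.of_forall fun x t _ => ?_
    have h1 : HasDerivAt (fun t : ℝ => A x + t * B x) (B x) t := by
      simpa using ((hasDerivAt_id t).mul_const (B x)).const_add (A x)
    have h2 := ((hasDerivAt_abs_rpow (A x + t * B x) hp).comp t h1).const_mul (1 / p)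
    refine h2.congr_deriv ?_
    have : p ≠ 0 := by linarith
    field_simp

lemma integrableOn_weighted_flux_mul {s : Side} {α p q k a b : ℝ} (hpq : p.HolderConjugate q)
    {u v : ℝ → ℝ} (hu : k = 0 ∨ u ∈ oneSidedSobolev s α p a b)
    (hv : k = 0 ∨ v ∈ oneSidedSobolev s α p a b) :
    IntegrableOn (fun x => k * (flux s α p a b u x * weakDeriv s α a b v x)) (Ioo a b) := by
  rcases hu with rfl | hu
  · simp
  rcases hv with rfl | hv
  · simp
  exact (integrable_mul_of_memLp hpq
    (memLp_abs_rpow_sub_two_mul_self hpq (memLp_weakDeriv hu)) (memLp_weakDeriv hv)).const_mul k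

lemma integrableOn_weighted_rpow {s : Side} {α p k a b : ℝ} (hp : 1 < p) {v : ℝ → ℝ}
    (hv : k = 0 ∨ v ∈ oneSidedSobolev s α p a b) :
    IntegrableOn (fun x => k * (1 / p * |weakDeriv s α a b v x| ^ p)) (Ioo a b) := by
  rcases hv with rfl | hv
  · simp
  exact ((integrable_abs_rpow hp (memLp_weakDeriv hv)).const_mul _).const_mul k

lemma hasDerivAt_weighted_energy {s : Side} {α p k a b : ℝ} (h0 : 0 < α) (h1 : α < 1) (hp : 1 < p)
    {u v : ℝ → ℝ} (hu : k = 0 ∨ u ∈ oneSidedSobolev s α p a b)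
    (hv : k = 0 ∨ v ∈ oneSidedSobolev s α p a b) :
    HasDerivAt (fun t : ℝ => ∫ x in Ioo a b,
        k * (1 / p * |weakDeriv s α a b (fun x => u x + t * v x) x| ^ p))
      (∫ x in Ioo a b, k * (flux s α p a b u x * weakDeriv s α a b v x)) 0 := by
  rcases hu with rfl | hu
  · simpa using hasDerivAt_const (0 : ℝ) (0 : ℝ)
  rcases hv with rfl | hv
  · simpa using hasDerivAt_const (0 : ℝ) (0 : ℝ)
  have h := (hasDerivAt_integral_abs_rpow hp (memLp_weakDeriv hu) (memLp_weakDeriv hv)).const_mul k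
  rw [← integral_const_mul] at h
  refine h.congr_of_eventuallyEq (Eventually.of_forall fun t => ?_)
  beta_reduce
  rw [← integral_const_mul]
  -- `weakDeriv` picks a representative separately for each function, so it is linear in the
  -- function only up to null sets.
  refine integral_congr_ae ?_
  filter_upwards [((isWeakDeriv_weakDeriv hu).add_mul h0 h1
    (isWeakDeriv_weakDeriv hv) t).weakDeriv_ae_eq] with x hx
  rw [hx]

lemma energy_eq {α p q θ lam a b : ℝ} (hpq : p.HolderConjugate q) {f v : ℝ → ℝ}
    (hf : MemLp f (ENNReal.ofReal q) (volume.restrict (Ioo a b)))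
    (hv : v ∈ energySpace α p θ lam a b) :
    energy α p θ lam a b f v
      = (∫ x in Ioo a b, (1 - θ) * (1 / p * |weakDeriv .left α a b v x| ^ p))
        + (∫ x in Ioo a b, θ * (1 / p * |weakDeriv .right α a b v x| ^ p))
        + lam * (∫ x in Ioo a b, 1 / p * |v x| ^ p) - ∫ x in Ioo a b, f x * v x := by
  have i1 := integrableOn_weighted_rpow hpq.lt (energySpace_left hv)
  have i2 := integrableOn_weighted_rpow hpq.lt (energySpace_right hv)
  have i3 := (integrable_abs_rpow hpq.lt (memLp_of_mem_energySpace hv)).const_mul (1 / p)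
  have i4 := integrable_mul_of_memLp hpq hf (memLp_of_mem_energySpace hv)
  have i12 : IntegrableOn (fun x => (1 - θ) * (1 / p * |weakDeriv .left α a b v x| ^ p)
      + θ * (1 / p * |weakDeriv .right α a b v x| ^ p)) (Ioo a b) := i1.add i2
  have i123 : IntegrableOn (fun x => (1 - θ) * (1 / p * |weakDeriv .left α a b v x| ^ p)
      + θ * (1 / p * |weakDeriv .right α a b v x| ^ p) + lam * (1 / p * |v x| ^ p)) (Ioo a b) :=
    i12.add (i3.const_mul lam)
  rw [← integral_const_mul, ← integral_add i1 i2, ← integral_add i12 (i3.const_mul lam),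
    ← integral_sub i123 i4]
  refine integral_congr_ae (Eventually.of_forall fun x => ?_)
  simp only
  ring

lemma integral_weak_form_eq {α p q θ lam a b : ℝ} (hpq : p.HolderConjugate q)
    {u v : ℝ → ℝ} (hu : u ∈ energySpace α p θ lam a b) (hv : v ∈ energySpace α p θ lam a b) :
    ∫ x in Ioo a b, ((1 - θ) * (flux .left α p a b u x * weakDeriv .left α a b v x)
        + θ * (flux .right α p a b u x * weakDeriv .right α a b v x)
        + lam * (|u x| ^ (p - 2) * u x * v x))
      = (∫ x in Ioo a b, (1 - θ) * (flux .left α p a b u x * weakDeriv .left α a b v x))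
        + (∫ x in Ioo a b, θ * (flux .right α p a b u x * weakDeriv .right α a b v x))
        + lam * ∫ x in Ioo a b, |u x| ^ (p - 2) * u x * v x := by
  have i1 := integrableOn_weighted_flux_mul hpq (energySpace_left hu) (energySpace_left hv)
  have i2 := integrableOn_weighted_flux_mul hpq (energySpace_right hu) (energySpace_right hv)
  have i3 := integrable_mul_of_memLp hpq (memLp_abs_rpow_sub_two_mul_self hpq
    (memLp_of_mem_energySpace hu)) (memLp_of_mem_energySpace hv)
  have i12 : IntegrableOn (fun x => (1 - θ) * (flux .left α p a b u x * weakDeriv .left α a b v x)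
      + θ * (flux .right α p a b u x * weakDeriv .right α a b v x)) (Ioo a b) := i1.add i2
  rw [integral_add i12 (i3.const_mul lam), integral_add i1 i2, integral_const_mul lam]

/-- The first variation of the energy vanishes at minimizers. -/
lemma IsMinimizer.satisfiesWeakForm {α p q θ lam a b : ℝ} (hab : a < b) (h0 : 0 < α) (h1 : α < 1)
    (hpq : p.HolderConjugate q) {f u : ℝ → ℝ}
    (hf : MemLp f (ENNReal.ofReal q) (volume.restrict (Ioo a b)))
    (hu : IsMinimizer α p θ lam a b f u) : SatisfiesWeakForm α p θ lam a b f u := by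
  intro v hv
  have huL := memLp_of_mem_energySpace hu.1
  have hvL := memLp_of_mem_energySpace hv
  have d1 := hasDerivAt_weighted_energy h0 h1 hpq.lt (energySpace_left hu.1) (energySpace_left hv)
  have d2 := hasDerivAt_weighted_energy h0 h1 hpq.lt (energySpace_right hu.1) (energySpace_right hv)
  have d3 := (hasDerivAt_integral_abs_rpow hpq.lt huL hvL).const_mul lam
  have iu := integrable_mul_of_memLp hpq hf huL
  have iv := integrable_mul_of_memLp hpq hf hvL
  have d4 : HasDerivAt (fun t : ℝ => ∫ x in Ioo a b, f x * (u x + t * v x))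
      (∫ x in Ioo a b, f x * v x) 0 := by
    have e : (fun t : ℝ => ∫ x in Ioo a b, f x * (u x + t * v x))
        = fun t => (∫ x in Ioo a b, f x * u x) + t * ∫ x in Ioo a b, f x * v x := by
      ext t
      rw [← integral_const_mul, ← integral_add iu (iv.const_mul t)]
      congr 1; ext x; ring
    rw [e]
    simpa using ((hasDerivAt_id (0 : ℝ)).mul_const (∫ x in Ioo a b, f x * v x)).const_add
      (∫ x in Ioo a b, f x * u x)
  have d := ((d1.add d2).add d3).sub d4
  have hmin : IsLocalMin (fun t : ℝ => energy α p θ lam a b f (fun x => u x + t * v x)) 0 :=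
    Eventually.of_forall fun t => by
      simpa using hu.2 _ (energySpace_add_mul hab h0 h1 hu.1 hv t)
  -- Fermat's criterion applied to the energy on the line through `u` in direction `v`, split into
  -- its four terms.
  have := hmin.hasDerivAt_eq_zero (d.congr_of_eventuallyEq (Eventually.of_forall fun t =>
    energy_eq hpq hf (energySpace_add_mul hab h0 h1 hu.1 hv t)))
  rw [integral_weak_form_eq hpq hu.1 hv]
  linarith

lemma SatisfiesWeakForm.satisfiesEulerLagrange {α p q θ lam a b : ℝ} (hab : a < b) (h0 : 0 < α)
    (h1 : α < 1) (hpq : p.HolderConjugate q) {f u : ℝ → ℝ} (hu : u ∈ energySpace α p θ lam a b)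
    (h : SatisfiesWeakForm α p θ lam a b f u) : SatisfiesEulerLagrange α p θ lam a b f u := by
  intro φ hφ
  have hφ' : φ ∈ energySpace α p θ lam a b := hφ.mem_energySpace hab h0 h1
  rw [← h φ hφ', integral_weak_form_eq hpq hu hφ', integral_const_mul, integral_const_mul]
  have e : ∀ s, pLaplacian s α p a b u φ
      = ∫ x in Ioo a b, flux s α p a b u x * weakDeriv s α a b φ x := fun s =>
    integral_congr_ae ((hφ.isWeakDeriv s h0 h1).weakDeriv_ae_eq.mono fun x hx => by
      simp only [hx])
  rw [e, e]

/-! ### Natural boundary conditions -/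

lemma memLp_flux {s : Side} {α p q a b : ℝ} (hpq : p.HolderConjugate q) {u : ℝ → ℝ}
    (hu : u ∈ oneSidedSobolev s α p a b) :
    MemLp (flux s α p a b u) (ENNReal.ofReal q) (volume.restrict (Ioo a b)) :=
  memLp_abs_rpow_sub_two_mul_self hpq (memLp_weakDeriv hu)

/-- If only the derivative of direction `s` enters the weak form, the Neumann flux is a primitive
of the right-hand side. -/
lemma neumannFlux_ae_eq {s : Side} {α p q a b : ℝ} (hab : a < b) (h0 : 0 < α) (h1 : α < 1)
    (hpq : p.HolderConjugate q) {u g : ℝ → ℝ} (hu : u ∈ oneSidedSobolev s α p a b)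
    (hg : IntegrableOn g (Ioo a b))
    (h : ∀ v ∈ ringSobolev s α p a b,
      ∫ x in Ioo a b, flux s α p a b u x * weakDeriv s α a b v x = ∫ x in Ioo a b, g x * v x) :
    neumannFlux s α p a b u =ᵐ[volume.restrict (Ioo a b)] fracInt s.opp 1 a b g := by
  have h1' : 0 < 1 - α := by linarith
  have h1'' : 1 - α ≤ 1 := by linarith
  have hw : IntegrableOn (flux s α p a b u) (Ioo a b) :=
    MemLp.integrableOn_Ioo hpq.symm.lt (memLp_flux hpq hu)
  refine ae_eq_of_forall_isTest
    (IntegrableOn.locallyIntegrableOn (integrableOn_fracInt s.opp h1' h1'' hw))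
    (IntegrableOn.locallyIntegrableOn (integrableOn_fracInt s.opp one_pos le_rfl hg))
    fun φ hφ => ?_
  -- The variation is `I^α` of this function: its weak derivative is `I^{1-α} φ` and it equals `I^1
  -- φ`. Moving these integrals off `φ` leaves the Neumann flux on one side and the primitive of `g`
  -- on the other.
  have hb : BddMeas a b (fracInt s (1 - α) a b φ) := hφ.bddMeas.fracInt s h1' h1''
  rw [neumannFlux, integral_fracInt_mul s.opp h1' h1'' hw hφ.bddMeas,
    integral_fracInt_mul s.opp one_pos le_rfl hg hφ.bddMeas, Side.opp_opp]
  have := h _ (hb.fracInt_mem_ringSobolev hab s h0 h1 p)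
  calc ∫ x in Ioo a b, flux s α p a b u x * fracInt s (1 - α) a b φ x
      = ∫ x in Ioo a b, flux s α p a b u x
          * weakDeriv s α a b (fracInt s α a b (fracInt s (1 - α) a b φ)) x :=
        integral_congr_ae ((isWeakDeriv_fracInt s h0 h1 hb.integrableOn).weakDeriv_ae_eq.mono
          fun x hx => by simp only [hx])
    _ = ∫ x in Ioo a b, g x * fracInt s α a b (fracInt s (1 - α) a b φ) x := this
    _ = _ := setIntegral_congr_fun measurableSet_Ioo fun x hx => by
        simp only [fracInt_fracInt s h0 h1 hφ.bddMeas hx]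

lemma LayerSmall.const_mul {s : Side} {γ a b : ℝ} {F : ℝ → ℝ} (k : ℝ)
    (h : LayerSmall s γ a b (fun x => ‖F x‖ₑ)) : LayerSmall s γ a b (fun x => ‖k * F x‖ₑ) := by
  have := ENNReal.Tendsto.const_mul (a := ‖k‖ₑ) h (Or.inr enorm_ne_top)
  rw [mul_zero] at this
  refine this.congr fun ε => ?_
  simp_rw [enorm_mul]
  rw [lintegral_const_mul' _ _ enorm_ne_top]
  ring

lemma hasMeanTrace_zero_fun (s : Side) (a b : ℝ) : HasMeanTrace s a b (fun _ => 0) 0 :=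
  ⟨⟨1, one_pos, integrableOn_zero⟩, by simp⟩

lemma aestronglyMeasurable_neumannFlux {s : Side} {α p q a b : ℝ} (h0 : 0 < α) (h1 : α < 1)
    (hpq : p.HolderConjugate q) {u : ℝ → ℝ} (hu : u ∈ oneSidedSobolev s α p a b) :
    AEStronglyMeasurable (neumannFlux s α p a b u) (volume.restrict (Ioo a b)) :=
  (integrableOn_fracInt s.opp (by linarith) (by linarith)
    (MemLp.integrableOn_Ioo hpq.symm.lt (memLp_flux hpq hu))).aestronglyMeasurable

/-- Natural boundary condition of direction `s`, when both directions enter the energy. -/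
lemma neumannVanishes_of_subset_inter {s : Side} {α p q k a b : ℝ} (hab : a < b) (h0 : 0 < α)
    (h1 : α < 1) (hpq : p.HolderConjugate q) {V : Set (ℝ → ℝ)} {u : ℝ → ℝ}
    (hu : u ∈ oneSidedSobolev s α p a b)
    (hV : ∀ s, V ⊆ oneSidedSobolev s α p a b) : NeumannVanishes s k α p a b V u := by
  intro v hv
  have hs := hV s hv
  have ho := hV s.opp hv
  have hint : ∀ s', v ∈ oneSidedSobolev s' α p a b →
      IntegrableOn (weakDeriv s' α a b v) (Ioo a b) := fun s' h' =>
    MemLp.integrableOn_Ioo hpq.lt (memLp_weakDeriv h')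
  -- The direction `s.opp` is chosen so that `v`, like the Neumann flux, is integrated from the
  -- endpoint carrying the trace of direction `s`.
  have hrep := ae_eq_fracInt_of_isWeakDeriv hab h0 h1 (isWeakDeriv_weakDeriv ho)
    (by rw [Side.opp_opp]; exact isWeakDeriv_weakDeriv hs) (hint _ ho) (hint _ hs)
  have hm := aestronglyMeasurable_neumannFlux h0 h1 hpq hu
  simp only [mul_assoc]
  refine hasMeanTrace_zero_of_layerSmall hab ((hm.mul hs.1.1).const_mul k)
    (LayerSmall.const_mul k ?_)
  have := layerSmall_fracInt_mul_fracInt s.opp hab h0 h1 hpq (memLp_flux hpq hu)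
    (memLp_weakDeriv ho)
  rw [Side.opp_opp] at this
  exact this.mono hab (hrep.mono fun x hx => by rw [hx]; rfl)

lemma hasMeanTrace_neumannFlux {s : Side} {α p q k a b : ℝ} (hab : a < b) (h0 : 0 < α)
    (h1 : α < 1) (hpq : p.HolderConjugate q) {u : ℝ → ℝ}
    (hu : u ∈ oneSidedSobolev s α p a b) (hαp : α * p ≤ 1) :
    HasMeanTrace s a b (fun x => k * neumannFlux s α p a b u x) 0 := by
  have := layerSmall_fracInt_of_mul_le_one s.opp hab h1 h0 hpq hαp (memLp_flux hpq hu)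
  rw [Side.opp_opp] at this
  exact hasMeanTrace_zero_of_layerSmall hab
    ((aestronglyMeasurable_neumannFlux h0 h1 hpq hu).const_mul k) (this.const_mul k)

lemma hasTrace_neumannFlux_of_mul_lt_one {s : Side} {α p q k a b : ℝ} (hab : a < b) (h0 : 0 < α)
    (hpq : p.HolderConjugate q) {u : ℝ → ℝ}
    (hu : u ∈ oneSidedSobolev s α p a b) (hαp : α * p < 1) :
    HasTrace s a b (fun x => k * neumannFlux s α p a b u x) 0 := by
  have := (tendsto_fracInt_of_mul_lt_one s.opp hab h0 hpq hαp (memLp_flux hpq hu)).const_mul k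
  rwa [mul_zero] at this

lemma hasTrace_neumannFlux_of_ae_eq {s : Side} {α p k a b : ℝ} (hab : a < b) {u g : ℝ → ℝ}
    (hg : IntegrableOn g (Ioo a b))
    (h : neumannFlux s α p a b u =ᵐ[volume.restrict (Ioo a b)] fracInt s.opp 1 a b g) :
    HasTrace s a b (fun x => k * neumannFlux s α p a b u x) 0 := by
  have := ((tendsto_fracInt_one s.opp hab hg).congr'
    ((eventually_startFilter_of_ae hab h).mono fun x hx => hx.symm)).const_mul k
  rwa [mul_zero] at this

lemma neumannVanishes_of_ae_eq {s : Side} {α p q k a b : ℝ} (hab : a < b)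
    (hpq : p.HolderConjugate q) {V : Set (ℝ → ℝ)} {u g : ℝ → ℝ}
    (hg : MemLp g (ENNReal.ofReal q) (volume.restrict (Ioo a b)))
    (hV : V ⊆ {v | MemLp v (ENNReal.ofReal p) (volume.restrict (Ioo a b))})
    (h : neumannFlux s α p a b u =ᵐ[volume.restrict (Ioo a b)] fracInt s.opp 1 a b g) :
    NeumannVanishes s k α p a b V u := by
  intro v hv
  have hm := (integrableOn_fracInt s.opp one_pos le_rfl
    (MemLp.integrableOn_Ioo hpq.symm.lt hg)).aestronglyMeasurable.congr h.symm
  simp only [mul_assoc]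
  refine hasMeanTrace_zero_of_layerSmall hab ((hm.mul (hV hv).1).const_mul k)
    (LayerSmall.const_mul k ?_)
  have := layerSmall_fracInt_one_mul s.opp hab hpq hg (hV hv)
  rw [Side.opp_opp] at this
  exact this.mono hab (h.mono fun x hx => by rw [hx])

/-- For `θ = 0` the lower-order term moves to the right-hand side. Variations in `ringSobolev`
suffice, and these are admissible for either value of `lam`. -/
lemma SatisfiesWeakForm.neumannFlux_left_ae_eq {α p q lam a b : ℝ} (hab : a < b) (h0 : 0 < α)
    (h1 : α < 1) (hpq : p.HolderConjugate q) {f u : ℝ → ℝ}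
    (hf : MemLp f (ENNReal.ofReal q) (volume.restrict (Ioo a b)))
    (hu : u ∈ energySpace α p 0 lam a b) (h : SatisfiesWeakForm α p 0 lam a b f u) :
    neumannFlux .left α p a b u =ᵐ[volume.restrict (Ioo a b)]
      fracInt .right 1 a b (fun x => f x - lam * (|u x| ^ (p - 2) * u x)) := by
  have huL := memLp_abs_rpow_sub_two_mul_self hpq (memLp_of_mem_energySpace hu)
  refine neumannFlux_ae_eq (s := .left) hab h0 h1 hpq
    ((energySpace_left hu).resolve_left (by norm_num))
    (MemLp.integrableOn_Ioo hpq.symm.lt (hf.sub (huL.const_mul lam))) fun v hv => ?_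
  have hv' := ringSobolev_left_subset_energySpace (lam := lam) hv
  have hvL := memLp_of_mem_energySpace hv'
  have := h v hv'
  rw [integral_weak_form_eq hpq hu hv'] at this
  simp only [sub_zero, one_mul, zero_mul, integral_zero, add_zero] at this
  simp only [sub_mul, mul_assoc lam]
  rw [integral_sub (integrable_mul_of_memLp hpq hf hvL)
    ((integrable_mul_of_memLp hpq huL hvL).const_mul lam), integral_const_mul]
  linarith

lemma SatisfiesWeakForm.neumannFlux_right_ae_eq {α p q lam a b : ℝ} (hab : a < b) (h0 : 0 < α)
    (h1 : α < 1) (hpq : p.HolderConjugate q) {f u : ℝ → ℝ}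
    (hf : MemLp f (ENNReal.ofReal q) (volume.restrict (Ioo a b)))
    (hu : u ∈ energySpace α p 1 lam a b) (h : SatisfiesWeakForm α p 1 lam a b f u) :
    neumannFlux .right α p a b u =ᵐ[volume.restrict (Ioo a b)]
      fracInt .left 1 a b (fun x => f x - lam * (|u x| ^ (p - 2) * u x)) := by
  have huL := memLp_abs_rpow_sub_two_mul_self hpq (memLp_of_mem_energySpace hu)
  refine neumannFlux_ae_eq (s := .right) hab h0 h1 hpq
    ((energySpace_right hu).resolve_left (by norm_num))
    (MemLp.integrableOn_Ioo hpq.symm.lt (hf.sub (huL.const_mul lam))) fun v hv => ?_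
  have hv' := ringSobolev_right_subset_energySpace (lam := lam) hv
  have hvL := memLp_of_mem_energySpace hv'
  have := h v hv'
  rw [integral_weak_form_eq hpq hu hv'] at this
  simp only [sub_self, one_mul, zero_mul, integral_zero, zero_add] at this
  simp only [sub_mul, mul_assoc lam]
  rw [integral_sub (integrable_mul_of_memLp hpq hf hvL)
    ((integrable_mul_of_memLp hpq huL hvL).const_mul lam), integral_const_mul]
  linarith

/-- Natural boundary conditions of direction `s` with coefficient `k`, given either that both
directions enter the energy or that only `s` does. -/
lemma neumann_conditions {s : Side} {α p q k a b : ℝ} (hab : a < b) (h0 : 0 < α)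
    (h1 : α < 1) (hpq : p.HolderConjugate q) {V : Set (ℝ → ℝ)} {u : ℝ → ℝ} {P : Prop}
    (hu : k = 0 ∨ u ∈ oneSidedSobolev s α p a b)
    (hV : V ⊆ {v | MemLp v (ENNReal.ofReal p) (volume.restrict (Ioo a b))})
    (h : k = 0 ∨ (∃ g, MemLp g (ENNReal.ofReal q) (volume.restrict (Ioo a b)) ∧
      neumannFlux s α p a b u =ᵐ[volume.restrict (Ioo a b)] fracInt s.opp 1 a b g) ∨
      (¬ P ∧ ∀ s, V ⊆ oneSidedSobolev s α p a b)) :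
    NeumannVanishes s k α p a b V u ∧
    (P ∨ α * p < 1 → HasTrace s a b (fun x => k * neumannFlux s α p a b u x) 0) ∧
    (α * p ≤ 1 → HasMeanTrace s a b (fun x => k * neumannFlux s α p a b u x) 0) := by
  rcases eq_or_ne k 0 with rfl | hk
  · simp only [zero_mul, NeumannVanishes]
    exact ⟨fun _ _ => hasMeanTrace_zero_fun s a b, fun _ => tendsto_const_nhds,
      fun _ => hasMeanTrace_zero_fun s a b⟩
  have hu' := hu.resolve_left hk
  rcases h.resolve_left hk with ⟨g, hg, hJ⟩ | ⟨hP, hVs⟩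
  · exact ⟨neumannVanishes_of_ae_eq hab hpq hg hV hJ,
      fun _ => hasTrace_neumannFlux_of_ae_eq hab (MemLp.integrableOn_Ioo hpq.symm.lt hg) hJ,
      hasMeanTrace_neumannFlux hab h0 h1 hpq hu'⟩
  -- `P` stands for `θ = 0 ∨ θ = 1`. It fails here, so the trace is claimed only for `α * p < 1`,
  -- where size alone gives it.
  · exact ⟨neumannVanishes_of_subset_inter hab h0 h1 hpq hu' hVs,
      fun h => hasTrace_neumannFlux_of_mul_lt_one hab h0 hpq hu' (h.resolve_left hP),
      hasMeanTrace_neumannFlux hab h0 h1 hpq hu'⟩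

end FracVar

end

theorem mainTheorem10 (a b α p q θ lam : ℝ) (hab : a < b) (hα0 : 0 < α) (hα1 : α < 1)
    (hpq : p.HolderConjugate q) (hθ0 : 0 ≤ θ) (hθ1 : θ ≤ 1) (hlam : lam = 0 ∨ lam = 1)
    (f : ℝ → ℝ) (hf : MemLp f (ENNReal.ofReal q) (volume.restrict (Ioo a b)))
    (u : ℝ → ℝ) (hu : FracVar.IsMinimizer α p θ lam a b f u) :
    FracVar.SatisfiesEulerLagrange α p θ lam a b f u ∧
    FracVar.SatisfiesWeakForm α p θ lam a b f u ∧
    FracVar.NeumannVanishes .left (1 - θ) α p a b (FracVar.energySpace α p θ lam a b) u ∧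
    FracVar.NeumannVanishes .right θ α p a b (FracVar.energySpace α p θ lam a b) u ∧
    (θ = 0 ∨ θ = 1 ∨ α * p < 1 →
      FracVar.HasTrace .left a b
        (fun x => (1 - θ) * FracVar.neumannFlux .left α p a b u x) 0 ∧
      FracVar.HasTrace .right a b
        (fun x => θ * FracVar.neumannFlux .right α p a b u x) 0) ∧
    (α * p ≤ 1 →
      FracVar.HasMeanTrace .left a b
        (fun x => (1 - θ) * FracVar.neumannFlux .left α p a b u x) 0 ∧
      FracVar.HasMeanTrace .right a b
        (fun x => θ * FracVar.neumannFlux .right α p a b u x) 0) := by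
  have hweak := hu.satisfiesWeakForm hab hα0 hα1 hpq hf
  have hV : FracVar.energySpace α p θ lam a b
      ⊆ {v | MemLp v (ENNReal.ofReal p) (volume.restrict (Ioo a b))} :=
    fun v hv => FracVar.memLp_of_mem_energySpace hv
  have hg : MemLp (fun x => f x - lam * (|u x| ^ (p - 2) * u x)) (ENNReal.ofReal q)
      (volume.restrict (Ioo a b)) :=
    hf.sub ((FracVar.memLp_abs_rpow_sub_two_mul_self hpq (hV hu.1)).const_mul lam)
  have hmixed : ¬ (θ = 0 ∨ θ = 1) → ∀ s, FracVar.energySpace α p θ lam a b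
      ⊆ FracVar.oneSidedSobolev s α p a b := by
    intro hθ s v hv
    rw [not_or] at hθ
    cases s
    · exact (FracVar.energySpace_left hv).resolve_left (sub_ne_zero.2 (Ne.symm hθ.2))
    · exact (FracVar.energySpace_right hv).resolve_left hθ.1
  obtain ⟨l1, l2, l3⟩ := FracVar.neumann_conditions (P := θ = 0 ∨ θ = 1) hab hα0 hα1 hpq
    (FracVar.energySpace_left hu.1) hV (by
      by_cases hθ : θ = 0 ∨ θ = 1
      · rcases hθ with rfl | rfl
        · exact Or.inr (Or.inl ⟨_, hg, hweak.neumannFlux_left_ae_eq hab hα0 hα1 hpq hf hu.1⟩)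
        -- For `θ = 1` the left direction has coefficient zero and its conditions are trivial.
        · exact Or.inl (sub_self 1)
      · exact Or.inr (Or.inr ⟨hθ, hmixed hθ⟩))
  obtain ⟨r1, r2, r3⟩ := FracVar.neumann_conditions (P := θ = 0 ∨ θ = 1) hab hα0 hα1 hpq
    (FracVar.energySpace_right hu.1) hV (by
      by_cases hθ : θ = 0 ∨ θ = 1
      · rcases hθ with rfl | rfl
        · exact Or.inl rfl
        · exact Or.inr (Or.inl ⟨_, hg, hweak.neumannFlux_right_ae_eq hab hα0 hα1 hpq hf hu.1⟩)
      · exact Or.inr (Or.inr ⟨hθ, hmixed hθ⟩))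
  exact ⟨hweak.satisfiesEulerLagrange hab hα0 hα1 hpq hu.1, hweak, l1, r1,
    fun h => ⟨l2 (or_assoc.2 h), r2 (or_assoc.2 h)⟩, fun h => ⟨l3 h, r3 h⟩⟩
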